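/- Let $G=(V,\to)$ be a finite directed graph (self-loops allowed) and let $D$ be a depth-first forest of $G$, that is, the forest of discovery edges of some complete depth-first search of $G$, together with the order of discovery (the DFN). An edge $u\to v$ is a tree edge if $u$ is the parent of $v$ in $D$, a back edge if $v$ is an ancestor of $u$ in $D$ (every vertex being an ancestor of itself), and a cross/forward edge otherwise; let $B$ be the set of back edges. The lowest common ancestor (LCA) of two vertices in different trees of $D$ is a virtual root above all trees. Every vertex $h$ has a possible new element $x_h\notin V$, the exit created for the head $h$. Both algorithms return a 4-tuple $(V,X,\rightharpoonup,\rightsquigarrow)$ of vertices, exits, scheduling constraints and stabilization constraints. **Top-down algorithm** $\mathrm{ConstructWPO}^{TD}(G,D)$. For each maximal strongly connected component $G_i$ of $G$, with vertex set $V_i$, compute a 4-tuple and an exit $x_i$ by $\mathrm{sccWPO}(G_i,D)$; return the componentwise union of these 4-tuples, with the pairs $x_i\rightharpoonup v$ added for all edges $u\to v$ with $u\in V_i$, $v\in V_j$, $i\ne j$. Here $\mathrm{sccWPO}(G,D)$, for strongly connected $G=(V,\to)$, takes the vertex $h$ of minimum DFN. If no edge enters $h$, it returns $(\{h\},\emptyset,\emptyset,\emptyset)$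 with exit $h$. Otherwise, if $V=\{h\}$, it returns $(\{h\},\{x_h\},\{(h,x_h)\},\{(x_h,h)\})$ with exit $x_h$. Otherwise it puts $V'=(V\cup\{x_h\})\setminus\{h\}$ and ${\to'}={\to}|_{V'}\cup\{(v,x_h): v\in V,\ v\to h\}$, obtains $(V',X',\rightharpoonup',\rightsquigarrow')$ from the recursive call on $(V',\to')$ and $D|_{V'}$, and returns $(V,\ X'\cup\{x_h\},\ {\rightharpoonup'}\cup\{(h,v):v\in V,\ h\to v\},\ {\rightsquigarrow'}\cup\{(x_h,h)\})$ with exit $x_h$. **Bottom-up algorithm** $\mathrm{ConstructWPO}^{BU}(G,D,\mathit{false})$. Start with $X={\rightharpoonup}={\rightsquigarrow}=\emptyset$ and $\mathrm{rep}(v)=\mathrm{exit}[v]=v$ for all $v$. Remove all cross/forward edges from $\to$, storing $(u,v)$ in $R[\mathrm{LCA}(u,v)]$, and let $O[v]$ be the set of the remaining non-back edges into $v$. *Restoring at $h$* means: for each $(u,v)\in R[h]$, add $(u,\mathrm{rep}(v))$ to $\to$ and $(u,v)$ to $O[\mathrm{rep}(v)]$. For each $h\in V$ in descending DFN, restore at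 $h$ and then do the following. Let $P=\{\mathrm{rep}(p):(p,h)\in B\}$, $N=\emptyset$, and start a worklist with $P\setminus\{h\}$. While the worklist is non-empty, move some $v$ from it to $N$, and for each $(p,v)\in{\to}\setminus B$ put $\mathrm{rep}(p)$ on the worklist unless it is $h$, in $N$, or already there. If $P\neq\emptyset$: add $\mathrm{exit}[\mathrm{rep}(u)]\rightharpoonup v'$ for all $v\in N$ and $(u,v')\in O[v]$; add the new exit $x_h$ to $X$; add $\mathrm{exit}[\mathrm{rep}(p)]\rightharpoonup x_h$ for all $p\in P$, and $x_h\rightsquigarrow h$; set $\mathrm{exit}[h]:=x_h$; and merge the classes of all $v\in N$ with the class of $h$, with representative $h$. After the loop, restore at the virtual root, add $\mathrm{exit}[\mathrm{rep}(u)]\rightharpoonup v'$ for all $v$ with $\mathrm{rep}(v)=v$ and $(u,v')\in O[v]$, and return $(V,X,\rightharpoonup,\rightsquigarrow)$. Call $h\in V$ a *looped head* if $h\to h$ and there is also a back edge $p\to h$ with $p\neq h$. **Theorem.** The bottom-up algorithm (with $\mathit{lift}=\mathit{false}$) has a terminating run on $G$ and $D$. Whatever choices are made from the worklists, the 4-tuple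 that it returns has the same vertices $V$, the same exits $X$ and the same stabilization constraints $\rightsquigarrow$ as the one returned by $\mathrm{ConstructWPO}^{TD}(G,D)$, and the two relations $\rightharpoonup$ agree on all pairs other than $(h,h)$ and $(h,x_h)$ with $h$ a looped head. In particular, if there is no looped head (for example, if $G$ has no self-loops), then both algorithms construct the same WPO $(V,X,\rightharpoonup,\rightsquigarrow)$. -/

import Mathlib

/-! ## Depth-first search, depth-first forests, classification of edges -/

/-- A depth-first forest: the list of the vertices in the order of their discovery, and for each
vertex its parent (`none` at the roots). -/
structure DFForest (V : Type*) where
  order : List V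
  parent : V → Option V

/-- A state of a depth-first search: the vertices discovered so far (in the order of discovery),
the stack of vertices being explored (innermost first), and the parents recorded so far. -/
structure DFSState (V : Type*) where
  disc : List V
  stack : List V
  parent : V → Option V

/-- One step of a (nondeterministic) depth-first search of the directed graph with edge
relation `E`. -/
inductive DFSStep {V : Type*} (E : V → V → Prop) : DFSState V → DFSState V → Prop
  /-- The stack is empty: start a new tree at any undiscovered vertex. -/
  | root (l : List V) (par : V → Option V) (v : V) (hv : v ∉ l) :
      DFSStep E ⟨l, [], par⟩ ⟨l ++ [v], [v], par⟩
  /-- Discover `v` along the edge `u → v` out of the innermost vertex `u`. -/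
  | discover (l : List V) (st : List V) (par par' : V → Option V) (u v : V)
      (huv : E u v) (hv : v ∉ l) (hpar : par' v = some u) (hpar' : ∀ w, w ≠ v → par' w = par w) :
      DFSStep E ⟨l, u :: st, par⟩ ⟨l ++ [v], v :: u :: st, par'⟩
  /-- All successors of the innermost vertex `u` are discovered: `u` is finished. -/
  | finish (l : List V) (st : List V) (par : V → Option V) (u : V)
      (hu : ∀ v, E u v → v ∈ l) :
      DFSStep E ⟨l, u :: st, par⟩ ⟨l, st, par⟩

/-- `D` is a depth-first forest of the graph: it is recorded by some complete depth-first search. -/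
def IsDFF {V : Type*} (E : V → V → Prop) (D : DFForest V) : Prop :=
  Relation.ReflTransGen (DFSStep E) ⟨[], [], fun _ => none⟩ ⟨D.order, [], D.parent⟩ ∧
    ∀ v, v ∈ D.order

namespace DFForest

variable {V : Type*} (D : DFForest V)

open Classical in
/-- The depth-first number: the position in the order of discovery. -/
noncomputable def dfn (v : V) : ℕ := D.order.idxOf v

/-- `a` is an ancestor of `v` (every vertex is an ancestor of itself). -/
def Anc (a v : V) : Prop := Relation.ReflTransGen (fun x y => D.parent y = some x) a v

/-- The depth of a vertex, counted as its number of ancestors (one for a root). -/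
noncomputable def depth (v : V) : ℕ := {a | D.Anc a v}.ncard

/-- `a` is a lowest common ancestor of `u` and `v`. -/
def IsLCA (a u v : V) : Prop :=
  D.Anc a u ∧ D.Anc a v ∧ ∀ b, D.Anc b u → D.Anc b v → D.depth b ≤ D.depth a

/-- `u → v` is a back edge (`v` is an ancestor of `u`; in particular self-loops are back edges). -/
def IsBack (E : V → V → Prop) (u v : V) : Prop := E u v ∧ D.Anc v u

/-- `u → v` is a cross or forward edge: neither a tree edge nor a back edge. -/
def IsCrossFwd (E : V → V → Prop) (u v : V) : Prop :=
  E u v ∧ D.parent v ≠ some u ∧ ¬ D.Anc v u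

end DFForest

/-! ## The output of the algorithms -/

/-- The elements of `V ∪ X`: a vertex `v`, or the new exit `x_h` created for the head `h`. -/
inductive Node (V : Type*)
  | vtx (v : V)
  | exit (h : V)

/-- A 4-tuple `(V, X, ⇀, ⇢)`: vertices, exits, scheduling constraints, stabilization
constraints. -/
@[ext] structure WPOTuple (V : Type*) where
  verts : Set (Node V)
  exits : Set (Node V)
  sched : Node V → Node V → Prop
  stab : Node V → Node V → Prop

/-- What the construction for a strongly connected graph returns: a 4-tuple, a head, an exit. -/
structure SCCResult (V : Type*) where
  wpo : WPOTuple V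
  head : Node V
  exit : Node V

/-! ## The top-down recursive construction -/

/-- A directed graph whose vertices are among the elements of `Node V` (the recursion of the
top-down algorithm works on graphs that contain exits created before). -/
structure NGraph (V : Type*) where
  verts : Set (Node V)
  edge : Node V → Node V → Prop

namespace NGraph

variable {V : Type*} (G : NGraph V)

/-- The subgraph induced by a set of vertices. -/
def restrict (C : Set (Node V)) : NGraph V where
  verts := G.verts ∩ C
  edge a b := G.edge a b ∧ a ∈ C ∧ b ∈ C

/-- `C` is the vertex set of a strongly connected subgraph. -/
def IsSC (C : Set (Node V)) : Prop :=
  C ⊆ G.verts ∧ C.Nonempty ∧ ∀ u ∈ C, ∀ v ∈ C, Relation.ReflTransGen G.edge u v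

/-- `C` is the vertex set of a maximal strongly connected component. -/
def IsMaxSCC (C : Set (Node V)) : Prop := Maximal G.IsSC C

theorem IsMaxSCC.restrict_nonempty {G : NGraph V} {C : Set (Node V)} (hC : G.IsMaxSCC C) :
    (G.restrict C).verts.Nonempty := by
  obtain ⟨x, hx⟩ := hC.1.2.1
  exact ⟨x, hC.1.1 hx, hx⟩

/-- The graph in which the head `h` is replaced by its exit `x_h`, which becomes the target of the
edges into `h`. -/
def breakHead (h : V) : NGraph V where
  verts := (G.verts ∪ {Node.exit h}) \ {Node.vtx h}
  edge a b :=
    (G.edge a b ∧ a ∈ (G.verts ∪ {Node.exit h}) \ {Node.vtx h} ∧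
      b ∈ (G.verts ∪ {Node.exit h}) \ {Node.vtx h}) ∨
    (a ∈ G.verts ∧ G.edge a (Node.vtx h) ∧ b = Node.exit h)

/-- The number of vertices of the graph that are not exits (used only for termination). -/
noncomputable def size : ℕ := {v : V | Node.vtx v ∈ G.verts}.ncard

theorem size_restrict_le [Finite V] (C : Set (Node V)) : (G.restrict C).size ≤ G.size :=
  Set.ncard_le_ncard (fun _ hv => hv.1) (Set.toFinite _)

theorem size_breakHead_lt [Finite V] (h : V) (hh : Node.vtx h ∈ G.verts) :
    (G.breakHead h).size < G.size := by
  apply Set.ncard_lt_ncard _ (Set.toFinite _)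
  constructor
  · rintro v ⟨hv | hv, _⟩
    · exact hv
    · cases hv
  · intro hsub
    exact (hsub hh).2 rfl

/-- The graph `(V, E)` itself. -/
def ofRel (E : V → V → Prop) : NGraph V where
  verts := Set.range Node.vtx
  edge a b := ∃ u v, E u v ∧ a = Node.vtx u ∧ b = Node.vtx v

end NGraph

/-- Depth-first numbers on `Node V`. Exits do not belong to the forest; they get the number `⊤`,
which is compared only in graphs without other vertices. -/
noncomputable def DFForest.nodeDFN {V : Type*} (D : DFForest V) : Node V → WithTop ℕ
  | Node.vtx v => (D.dfn v : WithTop ℕ)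
  | Node.exit _ => ⊤

/-- The vertex with minimum depth-first number. -/
noncomputable def NGraph.minDFN {V : Type*} (D : DFForest V) (G : NGraph V)
    (hG : G.verts.Nonempty) : Node V :=
  Function.argminOn D.nodeDFN G.verts hG

theorem NGraph.minDFN_mem {V : Type*} (D : DFForest V) (G : NGraph V) (hG : G.verts.Nonempty) :
    G.minDFN D hG ∈ G.verts :=
  Function.argminOn_mem _ _ _

/-- `trivialWPO(h)`. -/
def trivialWPO {V : Type*} (h : Node V) : SCCResult V where
  wpo := ⟨{h}, ∅, fun _ _ => False, fun _ _ => False⟩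
  head := h
  exit := h

/-- `self-loopWPO(h)`. -/
def selfLoopWPO {V : Type*} (h : V) : SCCResult V where
  wpo :=
    ⟨{Node.vtx h}, {Node.exit h},
      fun a b => a = Node.vtx h ∧ b = Node.exit h,
      fun a b => a = Node.exit h ∧ b = Node.vtx h⟩
  head := Node.vtx h
  exit := Node.exit h

/-- The merge of the results `r C` for the maximal SCCs `C` of `G`, with the scheduling constraints
for the edges between different maximal SCCs. -/
def connectTD {V : Type*} (G : NGraph V) (r : {C : Set (Node V) // G.IsMaxSCC C} → SCCResult V) :
    WPOTuple V where
  verts := {a | ∃ C, a ∈ (r C).wpo.verts}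
  exits := {a | ∃ C, a ∈ (r C).wpo.exits}
  sched a b := (∃ C, (r C).wpo.sched a b) ∨
    ∃ C C' u, C ≠ C' ∧ G.edge u b ∧ u ∈ C.1 ∧ b ∈ C'.1 ∧ a = (r C).exit
  stab a b := ∃ C, (r C).wpo.stab a b

/-- The result of `sccWPO` for a strongly connected graph `G` with head `h` and at least two
vertices, from the 4-tuple `W'` of the modified graph. -/
def extendTD {V : Type*} (G : NGraph V) (h : V) (W' : WPOTuple V) : SCCResult V where
  wpo :=
    ⟨G.verts, W'.exits ∪ {Node.exit h},
      fun a b => W'.sched a b ∨ (a = Node.vtx h ∧ b ∈ G.verts ∧ G.edge (Node.vtx h) b),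
      fun a b => W'.stab a b ∨ (a = Node.exit h ∧ b = Node.vtx h)⟩
  head := Node.vtx h
  exit := Node.exit h

open Classical in
mutual

/-- `ConstructWPO^TD(G, D)`, on graphs over `Node V`. -/
noncomputable def constructTD {V : Type*} [Finite V] (D : DFForest V) (G : NGraph V) :
    WPOTuple V :=
  connectTD G fun C => sccWPO D (G.restrict C.1) C.2.restrict_nonempty
termination_by (G.size, 1)
decreasing_by
  rcases (G.size_restrict_le C.1).lt_or_eq with h | h
  · exact Prod.Lex.left _ _ h
  · rw [h]; exact Prod.Lex.right _ Nat.zero_lt_one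

/-- `sccWPO(G, D)`, for strongly connected graphs over `Node V`. The head is an exit created before
only if the graph consists of this exit alone, without edges. -/
noncomputable def sccWPO {V : Type*} [Finite V] (D : DFForest V) (G : NGraph V)
    (hG : G.verts.Nonempty) : SCCResult V :=
  match hh : G.minDFN D hG with
  | Node.exit x => trivialWPO (Node.exit x)
  | Node.vtx h =>
    if ¬ ∃ v ∈ G.verts, G.edge v (Node.vtx h) then trivialWPO (Node.vtx h)
    else if G.verts.ncard = 1 then selfLoopWPO h
    else extendTD G h (constructTD D (G.breakHead h))
termination_by (G.size, 0)
decreasing_by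
  exact Prod.Lex.left _ _ (G.size_breakHead_lt h (hh ▸ G.minDFN_mem D hG))

end

/-- `ConstructWPO^TD(G, D)` for the graph `G = (V, E)`. -/
noncomputable def ConstructWPOTD {V : Type*} [Finite V] (E : V → V → Prop) (D : DFForest V) :
    WPOTuple V :=
  constructTD D (NGraph.ofRel E)

/-! ## The bottom-up iterative construction -/

/-- The variables of the bottom-up algorithm: the current edges, the sets `X`, `⇀`, `⇢`, and the
maps `rep`, `exit`, `R` and `O`. The map `R` is indexed by `Option V`; the index `none` is a
virtual root above all trees of the forest, the lowest common ancestor of two vertices that lie in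
different trees. -/
structure BUState (V : Type*) where
  edge : V → V → Prop
  exits : Set (Node V)
  sched : Node V → Node V → Prop
  stab : Node V → Node V → Prop
  rep : V → V
  exit : V → Node V
  R : Option V → Set (V × V)
  O : V → Set (V × V)

namespace BUState

variable {V : Type*}

/-- `removeAllCrossForwardEdges()`: cross and forward edges are removed and stored at their lowest
common ancestors. -/
def removeAllCrossForwardEdges (E : V → V → Prop) (D : DFForest V) (s : BUState V) : BUState V :=
  { s with
    edge := fun u v => s.edge u v ∧ ¬ D.IsCrossFwd E u v
    R := fun a => s.R a ∪
      {e | D.IsCrossFwd E e.1 e.2 ∧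
        match a with
        | some h => D.IsLCA h e.1 e.2
        | none => ¬ ∃ b, D.Anc b e.1 ∧ D.Anc b e.2} }

/-- The initialization of all maps but `O`. -/
def start (E : V → V → Prop) : BUState V where
  edge := E
  exits := ∅
  sched _ _ := False
  stab _ _ := False
  rep v := v
  exit v := Node.vtx v
  R _ := ∅
  O _ := ∅

/-- The state before the main loop. -/
def init (E : V → V → Prop) (D : DFForest V) : BUState V :=
  let s := removeAllCrossForwardEdges E D (start E)
  { s with O := fun v => {e | e.2 = v ∧ s.edge e.1 v ∧ ¬ D.IsBack E e.1 v} }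

/-- `restoreCrossForwardEdges(h)`. -/
def restoreCrossForwardEdges (h : Option V) (s : BUState V) : BUState V :=
  { s with
    edge := fun u w => s.edge u w ∨ ∃ v, (u, v) ∈ s.R h ∧ w = s.rep v
    O := fun w => s.O w ∪ {e | e ∈ s.R h ∧ s.rep e.2 = w} }

/-- The representatives of the sources of the back edges into `h`. -/
def backReps (E : V → V → Prop) (D : DFForest V) (h : V) (s : BUState V) : Set V :=
  {q | ∃ p, D.IsBack E p h ∧ q = s.rep p}

/-- One round of the worklist loop: a pair `(W, N)` of the worklist and the set of the nested
representatives found so far is updated for some `v` in the worklist. -/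
inductive SearchStep (E : V → V → Prop) (D : DFForest V) (h : V) (s : BUState V) :
    Set V × Set V → Set V × Set V → Prop
  | pop (W N : Set V) (v : V) (hv : v ∈ W) :
      SearchStep E D h s (W, N)
        ((W \ {v}) ∪ {q | ∃ p, s.edge p v ∧ ¬ D.IsBack E p v ∧ q = s.rep p ∧
            q ∉ (N ∪ {v}) ∪ {h} ∪ (W \ {v})},
          N ∪ {v})

/-- `findNestedSCCs(h)` may return `N, P`. -/
def FindNestedSCCs (E : V → V → Prop) (D : DFForest V) (h : V) (s : BUState V)
    (N P : Set V) : Prop :=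
  P = s.backReps E D h ∧
    Relation.ReflTransGen (SearchStep E D h s) (P \ {h}, ∅) (∅, N)

/-- The scheduling constraints added for a representative `v`: from the exits of the sources of the
original edges recorded in `O[v]` to their original targets, and, if `lift` is set, also to `v`. -/
def newSched (E : V → V → Prop) (D : DFForest V) (lift : Bool) (s : BUState V) (v : V)
    (a b : Node V) : Prop :=
  (∃ u v', (u, v') ∈ s.O v ∧ a = s.exit (s.rep u) ∧ b = Node.vtx v') ∨
  (lift = true ∧ ∃ u, s.edge u v ∧ ¬ D.IsBack E u v ∧ a = s.exit (s.rep u) ∧ b = Node.vtx v)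

open Classical in
/-- The representatives after `merge(v, h)` for all `v ∈ N`. -/
noncomputable def mergeAll (s : BUState V) (N : Set V) (h : V) (w : V) : V :=
  if ∃ v ∈ N, s.rep w = s.rep v ∨ s.rep w = s.rep h then h else s.rep w

open Classical in
/-- The effect of `constructWPOForSCC(h)` when `findNestedSCCs(h)` returned `N, P` with `P ≠ ∅`. -/
noncomputable def addComponent (E : V → V → Prop) (D : DFForest V) (lift : Bool) (h : V)
    (N P : Set V) (s : BUState V) : BUState V :=
  { s with
    exits := s.exits ∪ {Node.exit h}
    sched := fun a b => s.sched a b ∨ (∃ v ∈ N, s.newSched E D lift v a b) ∨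
      (∃ p ∈ P, a = s.exit (s.rep p) ∧ b = Node.exit h)
    stab := fun a b => s.stab a b ∨ (a = Node.exit h ∧ b = Node.vtx h)
    exit := Function.update s.exit h (Node.exit h)
    rep := s.mergeAll N h }

/-- `constructWPOForSCC(h)` may lead from the state `s` to the state `t`. -/
def ConstructWPOForSCC (E : V → V → Prop) (D : DFForest V) (lift : Bool) (h : V)
    (s t : BUState V) : Prop :=
  ∃ N P, FindNestedSCCs E D h s N P ∧
    ((P = ∅ ∧ t = s) ∨ (P ≠ ∅ ∧ t = s.addComponent E D lift h N P))

/-- The main loop, over a list of vertices. -/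
inductive MainLoop (E : V → V → Prop) (D : DFForest V) (lift : Bool) :
    List V → BUState V → BUState V → Prop
  | nil (s : BUState V) : MainLoop E D lift [] s s
  | cons (h : V) (l : List V) (s t s' : BUState V)
      (hstep : ConstructWPOForSCC E D lift h (s.restoreCrossForwardEdges (some h)) t)
      (hrest : MainLoop E D lift l t s') : MainLoop E D lift (h :: l) s s'

/-- `connectWPOsOfMaximalSCCs()`, and the returned 4-tuple. -/
def connectWPOsOfMaximalSCCs (E : V → V → Prop) (D : DFForest V) (lift : Bool)
    (s : BUState V) : WPOTuple V where
  verts := Set.range Node.vtx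
  exits := s.exits
  sched a b := s.sched a b ∨ ∃ v, s.rep v = v ∧ s.newSched E D lift v a b
  stab := s.stab

end BUState

/-- `ConstructWPO^BU(G, D, lift)` for the graph `G = (V, E)` may return `W`: the vertices are
processed in the order of descending depth-first number, then the edges between different trees
(stored at the virtual root) are restored and the WPOs of the maximal SCCs are connected. -/
def ConstructWPOBU {V : Type*} (E : V → V → Prop) (D : DFForest V) (lift : Bool)
    (W : WPOTuple V) : Prop :=
  ∃ s, BUState.MainLoop E D lift D.order.reverse (BUState.init E D) s ∧
    W = (s.restoreCrossForwardEdges none).connectWPOsOfMaximalSCCs E D lift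

/-- `h` has a self-loop and is also the target of a back edge from another vertex, that is, `h` is
the head of a component with at least two vertices and carries a self-loop. -/
def IsLoopedHead {V : Type*} (E : V → V → Prop) (D : DFForest V) (h : V) : Prop :=
  E h h ∧ ∃ p, p ≠ h ∧ D.IsBack E p h

-- Both algorithms produce explicit tuples described by loop bodies. The body of `h` consists of the
-- descendants of `h` that can reach `h` inside the subtree of `h`. The decisive property of a
-- depth-first forest is `anc_of_edge`: an edge leaving the subtree of `h` ends at a number smaller
-- than that of `h`. So the vertex of least number in a strongly connected set is an ancestor of the
-- whole set. Bodies are strongly connected, two bodies that meet are nested, and vertices that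
-- reach each other through numbers at least `k` share their outermost head `repAt k`
-- (`IsDepthFirst.repAt_eq_of_reachable`).
--
-- Top-down: every graph in the recursion is induced on a union of bodies, plus exits without
-- outgoing edges (`IsLevel`). Its maximal strongly connected components are bodies and single
-- exits. Induction on the size of the body gives the result of `sccWPO` in closed form
-- (`isResultOf_sccWPO`): each head contributes its exit and the constraints `headSchedTD`.
--
-- Bottom-up: each intermediate state equals an explicit `buState j k`. The point is timing. A cross
-- or forward edge is restored exactly when the heads above both its ends are still to be processed,
-- so it is present for every body that contains both ends, and an edge between different classes is
-- recorded at the current representative of its target (`recordedAt_repAt`). The worklist computes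
-- a least backward-closed set, so choices do not matter and the loop is deterministic
-- (`constructWPOForSCC_iff`). Each head contributes `headSched`.
--
-- The two contributions differ only at a looped head `h`. There the top-down algorithm turns the
-- self-loop into the constraint from `h` to `h`, because it is an edge out of `h`, and loses it as
-- an edge into `x_h`, because `h` has been removed; the bottom-up algorithm treats it as a back
-- edge, which gives the constraint from `h` to `x_h`.

namespace DFForest

variable {V : Type*}

/-- The properties of depth-first forests on which the equivalence of the two constructions
depends. -/
structure IsDepthFirst (E : V → V → Prop) (D : DFForest V) : Prop where
  nodup : D.order.Nodup
  mem : ∀ v, v ∈ D.order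
  edge_of_parent : ∀ {u v}, D.parent v = some u → E u v
  dfn_parent : ∀ {u v}, D.parent v = some u → D.dfn u < D.dfn v
  anc_of_edge : ∀ {h u v}, D.Anc h u → E u v → D.dfn h ≤ D.dfn v → D.Anc h v

end DFForest

-- Depth-first search: the invariant and its consequences

namespace DFSState

variable {V : Type*}

/-- The forest recorded by a state of a depth-first search. -/
def forest (s : DFSState V) : DFForest V := ⟨s.disc, s.parent⟩

/-- The invariant of a depth-first search. -/
structure Invariant (E : V → V → Prop) (s : DFSState V) : Prop where
  nodup : s.disc.Nodup
  stack_sub : ∀ v ∈ s.stack, v ∈ s.disc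
  stack_sorted : s.stack.Pairwise fun a b => s.forest.dfn b < s.forest.dfn a
  stack_parent : ∀ v ∈ s.stack, ∀ u, s.parent v = some u → u ∈ s.stack
  parent : ∀ v u, s.parent v = some u →
    E u v ∧ u ∈ s.disc ∧ v ∈ s.disc ∧ s.forest.dfn u < s.forest.dfn v
  anc_stack : ∀ h ∈ s.stack, ∀ w ∈ s.disc, s.forest.dfn h ≤ s.forest.dfn w → s.forest.Anc h w
  -- Once the stack is empty, this field applies to every vertex and becomes
  -- `IsDepthFirst.anc_of_edge`.
  anc_finished : ∀ h, ∀ u ∈ s.disc, u ∉ s.stack → s.forest.Anc h u → ∀ v, E u v →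
    v ∈ s.disc ∧ (s.forest.dfn h ≤ s.forest.dfn v → s.forest.Anc h v)

theorem dfn_append {l l' : List V} {par par' : V → Option V} {v : V} (hv : v ∈ l) :
    DFForest.dfn ⟨l ++ l', par'⟩ v = DFForest.dfn ⟨l, par⟩ v := by
  classical
  simp [DFForest.dfn, List.idxOf_append_of_mem hv]

theorem dfn_lt_append_singleton {l : List V} {par : V → Option V} {u v : V} (hu : u ∈ l)
    (hv : v ∉ l) : DFForest.dfn ⟨l ++ [v], par⟩ u < DFForest.dfn ⟨l ++ [v], par⟩ v := by
  classical
  simp only [DFForest.dfn]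
  rw [List.idxOf_append_of_mem hu, List.idxOf_append_of_notMem hv]
  have := List.idxOf_lt_length_iff.2 hu
  omega

theorem Invariant.mem_of_anc {E : V → V → Prop} {s : DFSState V} (hs : s.Invariant E) {a b : V}
    (hab : s.forest.Anc a b) (hb : b ∈ s.disc) : a ∈ s.disc := by
  induction hab using Relation.ReflTransGen.head_induction_on with
  | refl => exact hb
  | head h _ _ => exact (hs.parent _ _ h).2.1

theorem Invariant.mem_stack_of_anc {E : V → V → Prop} {s : DFSState V} (hs : s.Invariant E)
    {a b : V} (hab : s.forest.Anc a b) (hb : b ∈ s.stack) : a ∈ s.stack := by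
  induction hab using Relation.ReflTransGen.head_induction_on with
  | refl => exact hb
  | head h _ ih => exact hs.stack_parent _ ih _ h

/-- The invariant is preserved when a new vertex `v` is put on a stack `st` whose elements are the
ancestors of `v`. -/
theorem Invariant.push {E : V → V → Prop} {l st : List V} {par par' : V → Option V} {v : V}
    (hs : Invariant E ⟨l, st, par⟩) (hv : v ∉ l) (hpar' : ∀ w, w ≠ v → par' w = par w)
    (hpar : ∀ u, par' v = some u → u ∈ st ∧ E u v)
    (hanc : ∀ h ∈ st, ∃ u, par' v = some u ∧ DFForest.dfn ⟨l, par⟩ h ≤ DFForest.dfn ⟨l, par⟩ u) :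
    Invariant E ⟨l ++ [v], v :: st, par'⟩ := by
  have hnone : par v = none := by
    rcases h : par v with _ | u
    · rfl
    · exact absurd (hs.parent v u h).2.2.1 hv
  -- The undiscovered `v` had no parent, so assigning it one destroys no chain of parents.
  have hmono : ∀ {a b}, DFForest.Anc ⟨l, par⟩ a b → DFForest.Anc ⟨l ++ [v], par'⟩ a b := by
    intro a b hab
    refine Relation.ReflTransGen.mono ?_ _ _ hab
    intro x y hxy
    have : y ≠ v := by
      rintro rfl
      simp [hnone] at hxy
    simpa [hpar' y this] using hxy
  -- Conversely, a chain ending at an old vertex avoids `v`, since parents of old vertices are old.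
  have hanti : ∀ {a b}, DFForest.Anc ⟨l ++ [v], par'⟩ a b → b ∈ l → DFForest.Anc ⟨l, par⟩ a b := by
    intro a b hab
    induction hab with
    | refl => exact fun _ => .refl
    | tail _ hxy ih =>
      intro hb
      have hne : _ ≠ v := fun h => hv (h ▸ hb)
      have hxy' := (hpar' _ hne).symm.trans hxy
      exact (ih (hs.parent _ _ hxy').2.1).tail hxy'
  have hsub : ∀ w ∈ st, w ∈ l := hs.stack_sub
  have hd : ∀ {w}, w ∈ l → DFForest.dfn ⟨l ++ [v], par'⟩ w = DFForest.dfn ⟨l, par⟩ w :=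
    fun h => dfn_append h
  have hlt : ∀ {w}, w ∈ l → DFForest.dfn ⟨l ++ [v], par'⟩ w < DFForest.dfn ⟨l ++ [v], par'⟩ v :=
    fun h => dfn_lt_append_singleton h hv
  constructor
  · refine List.nodup_append.2 ⟨hs.nodup, by simp, ?_⟩
    rintro a ha b hb rfl
    exact hv (List.mem_singleton.1 hb ▸ ha)
  · intro w hw
    rcases List.mem_cons.1 hw with rfl | hw
    · simp
    · simp [hsub w hw]
  · refine List.pairwise_cons.2 ⟨fun w hw => hlt (hsub w hw), ?_⟩
    refine hs.stack_sorted.imp_of_mem ?_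
    intro a b ha hb hab
    simp only [forest] at *
    rw [hd (hsub a ha), hd (hsub b hb)]
    exact hab
  · intro w hw u hu
    by_cases hwv : w = v
    · subst hwv
      exact List.mem_cons_of_mem _ (hpar u hu).1
    · have hw' := (List.mem_cons.1 hw).resolve_left hwv
      exact List.mem_cons_of_mem _ (hs.stack_parent w hw' u ((hpar' w hwv).symm.trans hu))
  · intro w u hu
    by_cases hwv : w = v
    · subst hwv
      have := hsub u (hpar u hu).1
      exact ⟨(hpar u hu).2, by simp [this], by simp, hlt this⟩
    · obtain ⟨h1, h2, h3, h4⟩ := hs.parent w u ((hpar' w hwv).symm.trans hu)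
      refine ⟨h1, List.mem_append_left _ h2, List.mem_append_left _ h3, ?_⟩
      simp only [forest] at *
      rwa [hd h2, hd h3]
  · intro h hh w hw hle
    simp only [forest] at *
    rcases List.mem_cons.1 hh with rfl | hh
    · rcases List.mem_append.1 hw with hw | hw
      · exact absurd (hlt hw) (not_lt.2 hle)
      · rw [List.mem_singleton.1 hw]
        exact .refl
    · rcases List.mem_append.1 hw with hw | hw
      · rw [hd (hsub h hh), hd hw] at hle
        exact hmono (hs.anc_stack h hh w hw hle)
      · rw [List.mem_singleton.1 hw]
        obtain ⟨u, hu, hle⟩ := hanc h hh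
        exact (hmono (hs.anc_stack h hh u (hsub u (hpar u hu).1) hle)).tail hu
  · intro h u hu hust hanc' w hw
    simp only [forest, List.mem_cons, not_or] at *
    have hu' : u ∈ l := by
      rcases List.mem_append.1 hu with hu | hu
      · exact hu
      · exact absurd (List.mem_singleton.1 hu) hust.1
    have h0 := hanti hanc' hu'
    obtain ⟨h1, h2⟩ := hs.anc_finished h u hu' hust.2 h0 w hw
    refine ⟨List.mem_append_left _ h1, fun hle => hmono (h2 ?_)⟩
    rwa [hd (hs.mem_of_anc h0 hu'), hd h1] at hle

/-- When `u` is finished, all its successors are discovered and its ancestors are still on the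
stack, so `anc_stack` supplies what `anc_finished` demands of `u`. The other two steps are pushes.
-/
theorem Invariant.step {E : V → V → Prop} {s t : DFSState V} (hs : s.Invariant E)
    (hst : DFSStep E s t) : t.Invariant E := by
  cases hst with
  | root l par v hv =>
    refine hs.push hv (fun _ _ => rfl) (fun u hu => ?_) (by simp)
    exact absurd (hs.parent v u hu).2.2.1 hv
  | discover l st par par' u v huv hv hpar hpar' =>
    refine hs.push hv hpar' (fun w hw => ?_) (fun h hh => ⟨u, hpar, ?_⟩)
    · rw [hpar] at hw
      cases hw
      exact ⟨List.mem_cons_self, huv⟩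
    · rcases List.mem_cons.1 hh with rfl | hh
      · exact le_rfl
      · exact ((List.pairwise_cons.1 hs.stack_sorted).1 h hh).le
  | finish l st par u hu =>
    have hsort := List.pairwise_cons.1 hs.stack_sorted
    refine ⟨hs.nodup, fun v hv => hs.stack_sub v (List.mem_cons_of_mem _ hv), hsort.2, ?_,
      hs.parent, fun h hh => hs.anc_stack h (List.mem_cons_of_mem _ hh), ?_⟩
    · intro v hv w hw
      rcases List.mem_cons.1 (hs.stack_parent v (List.mem_cons_of_mem _ hv) w hw) with rfl | h
      · exact absurd (hs.parent _ _ hw).2.2.2 (hsort.1 v hv).not_gt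
      · exact h
    · intro h w hw hwst hanc v hv
      by_cases hwu : w = u
      · subst hwu
        exact ⟨hu v hv, fun hle =>
          hs.anc_stack h (hs.mem_stack_of_anc hanc List.mem_cons_self) v (hu v hv) hle⟩
      · exact hs.anc_finished h w hw (by simp [hwu, hwst]) hanc v hv

theorem Invariant.empty {E : V → V → Prop} :
    Invariant E (⟨[], [], fun _ => none⟩ : DFSState V) := by
  constructor <;> simp

end DFSState

theorem IsDFF.isDepthFirst {V : Type*} {E : V → V → Prop} {D : DFForest V} (hD : IsDFF E D) :
    D.IsDepthFirst E := by
  obtain ⟨hrun, hall⟩ := hD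
  have hinv : DFSState.Invariant E ⟨D.order, [], D.parent⟩ := by
    generalize (⟨D.order, [], D.parent⟩ : DFSState V) = t at hrun
    induction hrun with
    | refl => exact DFSState.Invariant.empty
    | tail _ h ih => exact ih.step h
  exact ⟨hinv.nodup, hall, fun h => (hinv.parent _ _ h).1, fun h => (hinv.parent _ _ h).2.2.2,
    fun h he => (hinv.anc_finished _ _ (hall _) (by simp) h _ he).2⟩

-- Loop bodies and representatives

namespace DFForest

variable {V : Type*} {E : V → V → Prop} {D : DFForest V}

/-- The loop body of `h`: the descendants of `h` that can reach `h` without leaving the subtree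
of `h`. -/
def body (D : DFForest V) (E : V → V → Prop) (h : V) : Set V :=
  {v | D.Anc h v ∧ Relation.ReflTransGen (fun a b => E a b ∧ D.Anc h a ∧ D.Anc h b) v h}

theorem mem_body_self (h : V) : h ∈ D.body E h := ⟨.refl, .refl⟩

theorem mem_body_of_edge {h u v : V} (hv : v ∈ D.body E h) (huv : E u v) (hu : D.Anc h u) :
    u ∈ D.body E h :=
  ⟨hu, .head ⟨huv, hu, hv.1⟩ hv.2⟩

theorem mem_body_of_isBack {h p : V} (hp : D.IsBack E p h) : p ∈ D.body E h :=
  mem_body_of_edge (mem_body_self h) hp.1 hp.2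

theorem Anc.trans {a b c : V} (hab : D.Anc a b) (hbc : D.Anc b c) : D.Anc a c :=
  Relation.ReflTransGen.trans hab hbc

/-- The ancestors of a vertex form a chain. -/
theorem Anc.total {a b v : V} (ha : D.Anc a v) (hb : D.Anc b v) : D.Anc a b ∨ D.Anc b a := by
  induction ha with
  | refl => exact .inr hb
  | tail ha h ih =>
    rcases Relation.ReflTransGen.cases_tail hb with rfl | ⟨c, hc, hcb⟩
    · exact .inl (ha.tail h)
    · have : some c = some _ := hcb.symm.trans h
      cases this
      exact ih hc

theorem Anc.parent {a u v : V} (ha : D.Anc a v) (hne : a ≠ v) (huv : D.parent v = some u) :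
    D.Anc a u := by
  rcases Relation.ReflTransGen.cases_tail ha with rfl | ⟨c, hc, hcb⟩
  · exact absurd rfl hne
  · have : some c = some _ := hcb.symm.trans huv
    cases this
    exact hc


theorem IsDepthFirst.dfn_injective (hD : D.IsDepthFirst E) : Function.Injective D.dfn := by
  classical
  intro a b hab
  exact (List.idxOf_inj (hD.mem a)).1 hab

theorem IsDepthFirst.dfn_le (hD : D.IsDepthFirst E) {a b : V} (hab : D.Anc a b) :
    D.dfn a ≤ D.dfn b := by
  induction hab with
  | refl => exact le_rfl
  | tail _ h ih => exact ih.trans (hD.dfn_parent h).le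

theorem IsDepthFirst.dfn_lt (hD : D.IsDepthFirst E) {a b : V} (hab : D.Anc a b) (hne : a ≠ b) :
    D.dfn a < D.dfn b :=
  lt_of_le_of_ne (hD.dfn_le hab) fun h => hne (hD.dfn_injective h)

theorem IsDepthFirst.anc_of_dfn_le (hD : D.IsDepthFirst E) {a b v : V} (ha : D.Anc a v)
    (hb : D.Anc b v) (hle : D.dfn a ≤ D.dfn b) : D.Anc a b := by
  rcases ha.total hb with h | h
  · exact h
  · rw [hD.dfn_injective (le_antisymm hle (hD.dfn_le h))]
    exact .refl

/-- Tree edges lead from `w` down to `v` inside the subtree of `h`, and `v` reaches `h` there. -/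
theorem IsDepthFirst.mem_body_of_anc (hD : D.IsDepthFirst E) {h v w : V} (hv : v ∈ D.body E h)
    (hw : D.Anc h w) (hwv : D.Anc w v) : w ∈ D.body E h := by
  induction hwv using Relation.ReflTransGen.head_induction_on with
  | refl => exact hv
  | head hp _ ih => exact mem_body_of_edge (ih (hw.tail hp)) (hD.edge_of_parent hp) hw

theorem body_subset {a b : V} (hb : b ∈ D.body E a) : D.body E b ⊆ D.body E a := by
  intro v hv
  refine ⟨hb.1.trans hv.1, Relation.ReflTransGen.trans ?_ hb.2⟩
  exact Relation.ReflTransGen.mono (fun x y h => ⟨h.1, hb.1.trans h.2.1, hb.1.trans h.2.2⟩)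
    _ _ hv.2

/-- Both heads are ancestors of `v`, hence comparable, and `b` lies on the tree path from `a` to
`v`. With `body_subset`, bodies that meet are nested. -/
theorem IsDepthFirst.mem_body_of_dfn_le (hD : D.IsDepthFirst E) {a b v : V}
    (ha : v ∈ D.body E a) (hb : v ∈ D.body E b) (hle : D.dfn a ≤ D.dfn b) : b ∈ D.body E a :=
  hD.mem_body_of_anc ha (hD.anc_of_dfn_le ha.1 hb.1 hle) hb.1

/-- The alternative `r = v` keeps the set of candidates nonempty and lets a vertex of number below
`k` represent itself. -/
theorem exists_isRep (D : DFForest V) (E : V → V → Prop) (k : ℕ) (v : V) :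
    ∃ r, (v ∈ D.body E r ∧ (r = v ∨ k ≤ D.dfn r)) ∧
      ∀ g, v ∈ D.body E g → g = v ∨ k ≤ D.dfn g → D.dfn r ≤ D.dfn g := by
  have hne : {r | v ∈ D.body E r ∧ (r = v ∨ k ≤ D.dfn r)}.Nonempty := ⟨v, mem_body_self v, .inl rfl⟩
  exact ⟨Function.argminOn D.dfn _ hne, Function.argminOn_mem D.dfn _ hne, fun g hg hg' =>
    Function.argminOn_le D.dfn {r | v ∈ D.body E r ∧ (r = v ∨ k ≤ D.dfn r)} ⟨hg, hg'⟩⟩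

/-- The outermost head `r` with depth-first number at least `k` whose loop body contains `v`, or
`v` itself. -/
noncomputable def repAt (D : DFForest V) (E : V → V → Prop) (k : ℕ) (v : V) : V :=
  (D.exists_isRep E k v).choose

theorem mem_body_repAt (k : ℕ) (v : V) : v ∈ D.body E (D.repAt E k v) :=
  (D.exists_isRep E k v).choose_spec.1.1

theorem anc_repAt (k : ℕ) (v : V) : D.Anc (D.repAt E k v) v := (mem_body_repAt k v).1

theorem repAt_eq_or_le (k : ℕ) (v : V) : D.repAt E k v = v ∨ k ≤ D.dfn (D.repAt E k v) :=
  (D.exists_isRep E k v).choose_spec.1.2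

theorem dfn_repAt_le {k : ℕ} {v g : V} (hg : v ∈ D.body E g) (hk : g = v ∨ k ≤ D.dfn g) :
    D.dfn (D.repAt E k v) ≤ D.dfn g :=
  (D.exists_isRep E k v).choose_spec.2 g hg hk

theorem le_dfn_repAt {k : ℕ} {v : V} (hv : k ≤ D.dfn v) : k ≤ D.dfn (D.repAt E k v) := by
  rcases D.repAt_eq_or_le (E := E) k v with h | h
  · rwa [h]
  · exact h

theorem IsDepthFirst.repAt_eq (hD : D.IsDepthFirst E) {k : ℕ} {v r : V} (hr : v ∈ D.body E r)
    (hk : r = v ∨ k ≤ D.dfn r)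
    (hmin : ∀ g, v ∈ D.body E g → g = v ∨ k ≤ D.dfn g → D.dfn r ≤ D.dfn g) :
    D.repAt E k v = r :=
  hD.dfn_injective (le_antisymm (dfn_repAt_le hr hk)
    (hmin _ (mem_body_repAt k v) (repAt_eq_or_le k v)))

/-- The members of a loop body whose head counts have the same representative as the head. -/
theorem IsDepthFirst.repAt_eq_repAt (hD : D.IsDepthFirst E) {k : ℕ} {v w : V}
    (hv : v ∈ D.body E w) (hk : w = v ∨ k ≤ D.dfn w) : D.repAt E k v = D.repAt E k w := by
  rcases hk with rfl | hk
  · rfl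
  refine hD.repAt_eq (body_subset (mem_body_repAt k w) hv) (.inr (le_dfn_repAt hk)) ?_
  intro g hg hg'
  by_cases hle : D.dfn w ≤ D.dfn g
  · exact (dfn_repAt_le (mem_body_self w) (.inl rfl)).trans hle
  -- A smaller head `g` whose body shares `v` with that of `w` contains `w`, so it is a candidate
  -- for `w` as well.
  · refine dfn_repAt_le (hD.mem_body_of_dfn_le hg hv (not_le.1 hle).le) ?_
    rcases hg' with rfl | h
    · exact absurd (hD.dfn_le hv.1) hle
    · exact .inr h

theorem IsDepthFirst.repAt_repAt (hD : D.IsDepthFirst E) (k : ℕ) (v : V) :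
    D.repAt E k (D.repAt E k v) = D.repAt E k v :=
  (hD.repAt_eq_repAt (mem_body_repAt k v) (repAt_eq_or_le k v)).symm

/-- Raising the bound only removes candidates, so the minimum survives while it is itself admitted.
-/
theorem IsDepthFirst.repAt_mono (hD : D.IsDepthFirst E) {k j : ℕ} {v r : V}
    (hr : D.repAt E k v = r) (hkj : k ≤ j) (h : r = v ∨ j ≤ D.dfn r) : D.repAt E j v = r := by
  subst hr
  exact hD.repAt_eq (mem_body_repAt k v) h fun g hg hg' =>
    dfn_repAt_le hg (hg'.imp_right hkj.trans)

theorem IsDepthFirst.repAt_of_lt (hD : D.IsDepthFirst E) {k : ℕ} {v : V} (hv : D.dfn v < k) :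
    D.repAt E k v = v := by
  rcases D.repAt_eq_or_le (E := E) k v with h | h
  · exact h
  · exact absurd (h.trans (hD.dfn_le (anc_repAt k v))) (not_le.2 hv)

theorem IsDepthFirst.repAt_dfn (hD : D.IsDepthFirst E) {h v : V} (hv : v ∈ D.body E h) :
    D.repAt E (D.dfn h) v = h := by
  refine hD.repAt_eq hv (.inr le_rfl) fun g _ hg' => ?_
  rcases hg' with rfl | hg'
  · exact hD.dfn_le hv.1
  · exact hg'

/-- Lowering the bound from `D.dfn h + 1` to `D.dfn h` admits the single new head `h`. With
`repAt_dfn` this describes the whole effect of processing `h`. -/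
theorem IsDepthFirst.repAt_dfn_of_notMem (hD : D.IsDepthFirst E) {h v : V}
    (hv : v ∉ D.body E h) : D.repAt E (D.dfn h) v = D.repAt E (D.dfn h + 1) v := by
  symm
  refine hD.repAt_mono rfl (Nat.le_succ _) ?_
  rcases D.repAt_eq_or_le (E := E) (D.dfn h) v with h' | h'
  · exact .inl h'
  · refine .inr (lt_of_le_of_ne h' fun he => hv ?_)
    rw [hD.dfn_injective he]
    exact mem_body_repAt _ _

/-- Two vertices have the same representative as soon as one lies below the representative of a
successor. -/
theorem IsDepthFirst.repAt_eq_of_edge (hD : D.IsDepthFirst E) {k : ℕ} {u v : V} (huv : E u v)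
    (hu : D.Anc (D.repAt E k v) u) (hk : k ≤ D.dfn v) : D.repAt E k u = D.repAt E k v := by
  have h := mem_body_of_edge (mem_body_repAt k v) huv hu
  rw [hD.repAt_eq_repAt h (.inr (le_dfn_repAt hk)), hD.repAt_repAt]

theorem IsDepthFirst.not_anc_repAt (hD : D.IsDepthFirst E) {k : ℕ} {u v : V} (huv : E u v)
    (hk : k ≤ D.dfn v) (hne : D.repAt E k u ≠ D.repAt E k v) : ¬ D.Anc (D.repAt E k v) u :=
  fun h => hne (hD.repAt_eq_of_edge huv h hk)

theorem IsDepthFirst.mem_body_iff_repAt (hD : D.IsDepthFirst E) {k : ℕ} {u v : V}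
    (hk : k ≤ D.dfn v) :
    u ∈ D.body E (D.repAt E k v) ↔ D.repAt E k u = D.repAt E k v := by
  constructor
  · intro h
    rw [hD.repAt_eq_repAt h (.inr (le_dfn_repAt hk)), hD.repAt_repAt]
  · intro h
    rw [← h]
    exact mem_body_repAt k u

/-- In the body of `h`, the representatives above `h` lie in the body of `h` without `h`. -/
theorem IsDepthFirst.repAt_mem_body (hD : D.IsDepthFirst E) {h v : V} (hv : v ∈ D.body E h)
    (hne : v ≠ h) :
    D.repAt E (D.dfn h + 1) v ∈ D.body E h ∧ D.repAt E (D.dfn h + 1) v ≠ h := by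
  have h1 : D.dfn h + 1 ≤ D.dfn (D.repAt E (D.dfn h + 1) v) :=
    le_dfn_repAt (hD.dfn_lt hv.1 hne.symm)
  refine ⟨hD.mem_body_of_dfn_le hv (mem_body_repAt _ _) (by omega), fun he => ?_⟩
  rw [he] at h1
  omega

theorem IsDepthFirst.repAt_succ_self (hD : D.IsDepthFirst E) (h : V) :
    D.repAt E (D.dfn h + 1) h = h :=
  hD.repAt_of_lt (Nat.lt_succ_self _)

/-- Vertices that can reach each other in a set of vertices with depth-first numbers at least `k`
have the same representative. -/
theorem IsDepthFirst.repAt_eq_of_reachable (hD : D.IsDepthFirst E) {k : ℕ} {S : Set V}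
    (hS : ∀ v ∈ S, k ≤ D.dfn v) {u v : V} (hu : u ∈ S)
    (huv : Relation.ReflTransGen (fun a b => E a b ∧ a ∈ S ∧ b ∈ S) u v)
    (hvu : Relation.ReflTransGen (fun a b => E a b ∧ a ∈ S ∧ b ∈ S) v u) :
    D.repAt E k u = D.repAt E k v := by
  set R : V → V → Prop := fun a b => E a b ∧ a ∈ S ∧ b ∈ S with hR
  -- `M` is the strongly connected component of `u` within `S`, and its vertex `m` of least number
  -- will be the common head.
  let M : Set V := {w | Relation.ReflTransGen R u w ∧ Relation.ReflTransGen R w u}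
  have hM : M.Nonempty := ⟨u, .refl, .refl⟩
  obtain ⟨m, hm, hmin⟩ : ∃ m ∈ M, ∀ w ∈ M, D.dfn m ≤ D.dfn w :=
    ⟨Function.argminOn D.dfn M hM, Function.argminOn_mem _ _ _,
      fun w hw => Function.argminOn_le D.dfn M hw⟩
  -- A path inside the component never leaves the subtree of `m`: all its vertices have numbers at
  -- least that of `m`, so `anc_of_edge` applies to each edge.
  have hanc : ∀ w, Relation.ReflTransGen R m w → Relation.ReflTransGen R w u → D.Anc m w := by
    intro w hw
    induction hw with
    | refl => exact fun _ => .refl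
    | @tail b c hb hbc ih =>
      intro hc
      refine hD.anc_of_edge (ih (hc.head hbc)) hbc.1 (hmin _ ⟨hm.1.trans (hb.tail hbc), hc⟩)
  have hbody : ∀ w ∈ M, w ∈ D.body E m := by
    intro w hw
    refine ⟨hanc w (hm.2.trans hw.1) hw.2, ?_⟩
    have h1 : ∀ x, Relation.ReflTransGen R x m → Relation.ReflTransGen R u x →
        Relation.ReflTransGen (fun a b => E a b ∧ D.Anc m a ∧ D.Anc m b) x m := by
      intro x hx
      induction hx using Relation.ReflTransGen.head_induction_on with
      | refl => exact fun _ => .refl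
      | @head a c hac hcm ih =>
        intro ha
        exact .head ⟨hac.1, hanc _ (hm.2.trans ha) ((hcm.head hac).trans hm.2),
          hanc _ (hm.2.trans (ha.tail hac)) (hcm.trans hm.2)⟩ (ih (ha.tail hac))
    exact h1 w (hw.2.trans hm.1) hw.1
  have hmS : m ∈ S := by
    rcases Relation.ReflTransGen.cases_tail hm.1 with h | ⟨c, _, hc⟩
    · rwa [h]
    · exact hc.2.2
  rw [hD.repAt_eq_repAt (hbody u ⟨.refl, .refl⟩) (.inr (hS m hmS)),
    hD.repAt_eq_repAt (hbody v ⟨huv, hvu⟩) (.inr (hS m hmS))]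

/-- Loop bodies are strongly connected. -/
theorem IsDepthFirst.reachable_of_mem_body (hD : D.IsDepthFirst E) {h u v : V}
    (hu : u ∈ D.body E h) (hv : v ∈ D.body E h) :
    Relation.ReflTransGen (fun a b => E a b ∧ a ∈ D.body E h ∧ b ∈ D.body E h) u v := by
  have h1 : Relation.ReflTransGen (fun a b => E a b ∧ a ∈ D.body E h ∧ b ∈ D.body E h) u h := by
    replace hu := hu.2
    induction hu using Relation.ReflTransGen.head_induction_on with
    | refl => exact .refl
    | head hac hch ih =>
      exact .head ⟨hac.1, ⟨hac.2.1, hch.head hac⟩, ⟨hac.2.2, hch⟩⟩ ih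
  refine h1.trans ?_
  -- From `h` the tree path leads down to `v`, and it stays in the body.
  have h2 := hv.1
  have h3 : ∀ w, D.Anc h w → D.Anc w v →
      Relation.ReflTransGen (fun a b => E a b ∧ a ∈ D.body E h ∧ b ∈ D.body E h) h w := by
    intro w hw
    induction hw with
    | refl => exact fun _ => .refl
    | @tail b c hb hbc ih =>
      intro hc
      have hbv : D.Anc b v := Relation.ReflTransGen.head hbc hc
      exact (ih hbv).tail ⟨hD.edge_of_parent hbc, hD.mem_body_of_anc hv hb hbv,
        hD.mem_body_of_anc hv (hb.tail hbc) hc⟩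
  exact h3 v h2 .refl

-- Exits and scheduling constraints in closed form

open Classical in
/-- The exit of the component with head `r`. -/
noncomputable def exitOf (D : DFForest V) (E : V → V → Prop) (r : V) : Node V :=
  if ∃ p, D.IsBack E p r then Node.exit r else Node.vtx r

open Classical in
/-- The exit of the component with head `r` when the heads with depth-first number at least `k` have
been processed. -/
noncomputable def exitAt (D : DFForest V) (E : V → V → Prop) (k : ℕ) (r : V) : Node V :=
  if k ≤ D.dfn r then D.exitOf E r else Node.vtx r

/-- The exit of the component that contains `u` when the heads with depth-first number at least `k`
have been processed. -/
noncomputable def srcAt (D : DFForest V) (E : V → V → Prop) (k : ℕ) (u : V) : Node V :=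
  D.exitAt E k (D.repAt E k u)

/-- The scheduling constraints that the bottom-up construction adds for the head `g`. -/
def headSched (D : DFForest V) (E : V → V → Prop) (g : V) (a b : Node V) : Prop :=
  (∃ u v, E u v ∧ u ∈ D.body E g ∧ v ∈ D.body E g ∧ v ≠ g ∧
    D.repAt E (D.dfn g + 1) u ≠ D.repAt E (D.dfn g + 1) v ∧
    a = D.srcAt E (D.dfn g + 1) u ∧ b = Node.vtx v) ∨
  ∃ u, E u g ∧ u ∈ D.body E g ∧ a = D.srcAt E (D.dfn g + 1) u ∧ b = Node.exit g

/-- The scheduling constraints that the top-down construction adds for the head `g`. -/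
def headSchedTD (D : DFForest V) (E : V → V → Prop) (g : V) (a b : Node V) : Prop :=
  (D.headSched E g a b ∧ ¬ (IsLoopedHead E D g ∧ a = Node.vtx g ∧ b = Node.exit g)) ∨
  (IsLoopedHead E D g ∧ a = Node.vtx g ∧ b = Node.vtx g)

/-- The scheduling constraints between the maximal strongly connected components. -/
def topSched (D : DFForest V) (E : V → V → Prop) (a b : Node V) : Prop :=
  ∃ u v, E u v ∧ D.repAt E 0 u ≠ D.repAt E 0 v ∧ a = D.srcAt E 0 u ∧ b = Node.vtx v

theorem srcAt_of_le {k : ℕ} {u : V} (hu : k ≤ D.dfn u) :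
    D.srcAt E k u = D.exitOf E (D.repAt E k u) :=
  if_pos (le_dfn_repAt hu)

theorem IsDepthFirst.srcAt_succ_self (hD : D.IsDepthFirst E) (g : V) :
    D.srcAt E (D.dfn g + 1) g = Node.vtx g := by
  rw [srcAt, hD.repAt_succ_self, exitAt, if_neg (by omega)]

theorem exitOf_ne_vtx {r g : V} (h : r ≠ g) : D.exitOf E r ≠ Node.vtx g := by
  unfold exitOf
  split <;> simp [h]

/-- Any other vertex of the body has a representative different from `g`. So in `headSched E g` the
pair of `g` and its exit can come only from a self-loop. -/
theorem IsDepthFirst.srcAt_succ_eq_vtx_iff (hD : D.IsDepthFirst E) {g u : V}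
    (hu : u ∈ D.body E g) : D.srcAt E (D.dfn g + 1) u = Node.vtx g ↔ u = g := by
  constructor
  · intro h
    by_contra hne
    rw [srcAt_of_le (hD.dfn_lt hu.1 (Ne.symm hne))] at h
    exact exitOf_ne_vtx (hD.repAt_mem_body hu hne).2 h
  · rintro rfl
    exact hD.srcAt_succ_self u

-- The graphs of the top-down recursion and their components

/-- The subgraph induced by the body of `h`. -/
def bodyGraph (D : DFForest V) (E : V → V → Prop) (h : V) : NGraph V :=
  (NGraph.ofRel E).restrict (Node.vtx '' D.body E h)

theorem vtx_mem_bodyGraph {h v : V} :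
    Node.vtx v ∈ (D.bodyGraph E h).verts ↔ v ∈ D.body E h := by
  simp [bodyGraph, NGraph.restrict, NGraph.ofRel]

theorem bodyGraph_edge {h u v : V} : (D.bodyGraph E h).edge (Node.vtx u) (Node.vtx v) ↔
    E u v ∧ u ∈ D.body E h ∧ v ∈ D.body E h := by
  simp [bodyGraph, NGraph.restrict, NGraph.ofRel]

theorem bodyGraph_verts (h : V) : (D.bodyGraph E h).verts = Node.vtx '' D.body E h := by
  ext a
  simp only [bodyGraph, NGraph.restrict, NGraph.ofRel]
  constructor
  · exact fun h => h.2
  · rintro ⟨v, hv, rfl⟩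
    exact ⟨⟨v, rfl⟩, v, hv, rfl⟩

theorem bodyGraph_nonempty (h : V) : (D.bodyGraph E h).verts.Nonempty :=
  ⟨Node.vtx h, vtx_mem_bodyGraph.2 (mem_body_self h)⟩

theorem exists_of_bodyGraph_edge {h : V} {a b : Node V} (hab : (D.bodyGraph E h).edge a b) :
    ∃ u v, a = Node.vtx u ∧ b = Node.vtx v ∧ E u v ∧ u ∈ D.body E h ∧ v ∈ D.body E h := by
  obtain ⟨⟨u, v, huv, rfl, rfl⟩, ⟨u', hu, hu'⟩, v', hv, hv'⟩ := hab
  cases hu'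
  cases hv'
  exact ⟨u, v, rfl, rfl, huv, hu, hv⟩

/-- `G` is the graph induced by the set `S` of vertices, which is a union of loop bodies with heads
of depth-first number at least `k`, extended by exits without outgoing edges. -/
structure IsLevel (D : DFForest V) (E : V → V → Prop) (G : NGraph V) (S : Set V) (k : ℕ) :
    Prop where
  vtx_mem : ∀ v, Node.vtx v ∈ G.verts ↔ v ∈ S
  edge : ∀ u ∈ S, ∀ v ∈ S, (G.edge (Node.vtx u) (Node.vtx v) ↔ E u v)
  edge_vtx : ∀ a v, G.edge a (Node.vtx v) → v ∈ S ∧ ∃ u ∈ S, a = Node.vtx u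
  no_exit : ∀ x b, ¬ G.edge (Node.exit x) b
  dfn_le : ∀ v ∈ S, k ≤ D.dfn v
  body_sub : ∀ v ∈ S, D.body E (D.repAt E k v) ⊆ S

theorem isLevel_ofRel : D.IsLevel E (NGraph.ofRel E) Set.univ 0 := by
  constructor <;> simp [NGraph.ofRel]
  rintro a v u _ rfl
  exact ⟨u, rfl⟩

theorem IsDepthFirst.isLevel_breakHead (hD : D.IsDepthFirst E) (h : V) :
    D.IsLevel E ((D.bodyGraph E h).breakHead h) (D.body E h \ {h}) (D.dfn h + 1) := by
  have hv : ∀ v, Node.vtx v ∈ ((D.bodyGraph E h).breakHead h).verts ↔ v ∈ D.body E h \ {h} := by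
    intro v
    simp [NGraph.breakHead, vtx_mem_bodyGraph]
  have hlt : ∀ v ∈ D.body E h \ {h}, D.dfn h + 1 ≤ D.dfn v :=
    fun v hv => hD.dfn_lt hv.1.1 (Ne.symm hv.2)
  refine ⟨hv, ?_, ?_, ?_, hlt, ?_⟩
  · intro u hu v hv'
    constructor
    · rintro (⟨h1, _⟩ | ⟨_, _, h1⟩)
      · exact (bodyGraph_edge.1 h1).1
      · cases h1
    · exact fun huv => .inl ⟨bodyGraph_edge.2 ⟨huv, hu.1, hv'.1⟩, (hv u).2 hu, (hv v).2 hv'⟩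
  · rintro a v (⟨h1, h2, h3⟩ | ⟨_, _, h1⟩)
    · obtain ⟨u, v', rfl, _, _, _, _⟩ := exists_of_bodyGraph_edge h1
      exact ⟨(hv v).1 h3, u, (hv u).1 h2, rfl⟩
    · cases h1
  · rintro x b (⟨h1, _⟩ | ⟨_, h1, _⟩) <;>
    · obtain ⟨u, v, h2, _⟩ := exists_of_bodyGraph_edge h1
      cases h2
  · intro v hv'
    have h1 := hD.repAt_mem_body hv'.1 hv'.2
    -- The head `h` is not in the body of a nested representative, whose members have larger
    -- numbers.
    refine fun w hw => ⟨body_subset h1.1 hw, ?_⟩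
    rintro rfl
    have h2 := hD.dfn_le hw.1
    have h3 := le_dfn_repAt (E := E) (hlt v hv')
    omega

namespace IsLevel

variable {G : NGraph V} {S : Set V} {k : ℕ}

/-- Edges into a vertex start at vertices of `S`, so a path ending at a vertex passes through no
exit. -/
theorem reachable (hG : D.IsLevel E G S k) {a : Node V} {v : V} (hv : v ∈ S)
    (h : Relation.ReflTransGen G.edge a (Node.vtx v)) : ∃ u ∈ S, a = Node.vtx u ∧
      Relation.ReflTransGen (fun a b => E a b ∧ a ∈ S ∧ b ∈ S) u v := by
  induction h using Relation.ReflTransGen.head_induction_on with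
  | refl => exact ⟨v, hv, rfl, .refl⟩
  | head hac _ ih =>
    obtain ⟨u, hu, rfl, huv⟩ := ih
    obtain ⟨_, w, hw, rfl⟩ := hG.edge_vtx _ _ hac
    exact ⟨w, hw, rfl, huv.head ⟨(hG.edge w hw u hu).1 hac, hw, hu⟩⟩

theorem isSC_body (hG : D.IsLevel E G S k) (hD : D.IsDepthFirst E) {r : V}
    (hr : D.body E r ⊆ S) : G.IsSC (Node.vtx '' D.body E r) := by
  refine ⟨?_, ⟨_, r, mem_body_self r, rfl⟩, ?_⟩
  · rintro _ ⟨v, hv, rfl⟩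
    exact (hG.vtx_mem v).2 (hr hv)
  · rintro _ ⟨u, hu, rfl⟩ _ ⟨v, hv, rfl⟩
    refine Relation.ReflTransGen.lift Node.vtx ?_ _ _ (hD.reachable_of_mem_body hu hv)
    exact fun a b h => (hG.edge a (hr h.2.1) b (hr h.2.2)).2 h.1

theorem subset_body_of_isSC (hG : D.IsLevel E G S k) (hD : D.IsDepthFirst E) {C : Set (Node V)}
    (hC : G.IsSC C) {v : V} (hv : Node.vtx v ∈ C) :
    C ⊆ Node.vtx '' D.body E (D.repAt E k v) := by
  intro a ha
  have hvS := (hG.vtx_mem v).1 (hC.1 hv)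
  obtain ⟨u, hu, rfl, huv⟩ := hG.reachable hvS (hC.2.2 _ ha _ hv)
  obtain ⟨w, _, hw, hvu⟩ := hG.reachable hu (hC.2.2 _ hv _ ha)
  cases hw
  exact ⟨u, (hD.mem_body_iff_repAt (hG.dfn_le v hvS)).2
    (hD.repAt_eq_of_reachable hG.dfn_le hu huv hvu), rfl⟩

theorem eq_of_exit_mem (hG : D.IsLevel E G S k) {C : Set (Node V)}
    (hC : G.IsSC C) {x : V} (hx : Node.exit x ∈ C) : C = {Node.exit x} := by
  refine Set.Subset.antisymm (fun a ha => ?_) (by simpa using hx)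
  rcases Relation.ReflTransGen.cases_head (hC.2.2 _ hx _ ha) with h | ⟨c, hc, _⟩
  · exact h.symm
  · exact absurd hc (hG.no_exit x c)

theorem isMaxSCC_body (hG : D.IsLevel E G S k) (hD : D.IsDepthFirst E) {r : V} (hr : r ∈ S)
    (hrep : D.repAt E k r = r) : G.IsMaxSCC (Node.vtx '' D.body E r) := by
  have hsub := hG.body_sub r hr
  rw [hrep] at hsub
  refine ⟨hG.isSC_body hD hsub, fun C hC hle => ?_⟩
  have := hG.subset_body_of_isSC hD hC (hle ⟨r, mem_body_self r, rfl⟩)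
  rwa [hrep] at this

theorem isMaxSCC_exit (hG : D.IsLevel E G S k) {x : V}
    (hx : Node.exit x ∈ G.verts) : G.IsMaxSCC {Node.exit x} := by
  refine ⟨⟨by simpa using hx, ⟨_, rfl⟩, ?_⟩, fun C hC hle => ?_⟩
  · rintro _ rfl _ rfl
    exact .refl
  · exact (hG.eq_of_exit_mem hC (hle rfl)).le

/-- The component of a vertex lies in the body of its representative, which is itself strongly
connected; an exit is a sink and therefore alone. -/
theorem eq_of_isMaxSCC (hG : D.IsLevel E G S k) (hD : D.IsDepthFirst E) {C : Set (Node V)}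
    (hC : G.IsMaxSCC C) : (∃ r ∈ S, D.repAt E k r = r ∧ C = Node.vtx '' D.body E r) ∨
      ∃ x, Node.exit x ∈ G.verts ∧ C = {Node.exit x} := by
  obtain ⟨a, ha⟩ := hC.1.2.1
  cases a with
  | vtx v =>
    have hv := (hG.vtx_mem v).1 (hC.1.1 ha)
    have hsub := hG.body_sub v hv
    refine .inl ⟨D.repAt E k v, hsub (mem_body_self _), hD.repAt_repAt k v, ?_⟩
    have h1 := hG.subset_body_of_isSC hD hC.1 ha
    exact Set.Subset.antisymm h1 (hC.2 (hG.isSC_body hD hsub) h1)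
  | exit x => exact .inr ⟨x, hC.1.1 ha, hG.eq_of_exit_mem hC.1 ha⟩

/-- The recursive call on a body thus depends only on its head, not on the level at which it is
reached. -/
theorem restrict_body (hG : D.IsLevel E G S k) {r : V} (hr : D.body E r ⊆ S) :
    G.restrict (Node.vtx '' D.body E r) = D.bodyGraph E r := by
  simp only [bodyGraph, NGraph.restrict, NGraph.mk.injEq]
  constructor
  · ext a
    constructor
    · rintro ⟨_, v, hv, rfl⟩
      exact ⟨⟨v, rfl⟩, v, hv, rfl⟩
    · rintro ⟨_, v, hv, rfl⟩
      exact ⟨(hG.vtx_mem v).2 (hr hv), v, hv, rfl⟩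
  · funext a b
    refine propext (and_congr_left ?_)
    rintro ⟨⟨u, hu, rfl⟩, v, hv, rfl⟩
    rw [hG.edge u (hr hu) v (hr hv)]
    simp [NGraph.ofRel]

end IsLevel

end DFForest

-- Closed form of the top-down construction

section TopDown

variable {V : Type*} [Finite V]

theorem sccWPO_of_minDFN_exit (D : DFForest V) (G : NGraph V) (hG : G.verts.Nonempty) {x : V}
    (hx : G.minDFN D hG = Node.exit x) : sccWPO D G hG = trivialWPO (Node.exit x) := by
  rw [sccWPO]
  split
  · rename_i y hy
    rw [hx] at hy
    cases hy
    rfl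
  · rename_i y hy
    rw [hx] at hy
    cases hy

open Classical in
theorem sccWPO_of_minDFN_vtx (D : DFForest V) (G : NGraph V) (hG : G.verts.Nonempty) {h : V}
    (hh : G.minDFN D hG = Node.vtx h) : sccWPO D G hG =
      if ¬ ∃ v ∈ G.verts, G.edge v (Node.vtx h) then trivialWPO (Node.vtx h)
      else if G.verts.ncard = 1 then selfLoopWPO h
      else extendTD G h (constructTD D (G.breakHead h)) := by
  rw [sccWPO]
  split
  · rename_i y hy
    rw [hh] at hy
    cases hy
  · rename_i y hy
    rw [hh] at hy
    cases hy
    rfl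

theorem sccWPO_singleton_exit (D : DFForest V) (G : NGraph V) (x : V)
    (hG : (G.restrict {Node.exit x}).verts.Nonempty) :
    sccWPO D (G.restrict {Node.exit x}) hG = trivialWPO (Node.exit x) :=
  sccWPO_of_minDFN_exit D _ hG (NGraph.minDFN_mem D _ hG).2

theorem sccWPO_congr {D : DFForest V} {G G' : NGraph V} (h : G = G') (hG : G.verts.Nonempty)
    (hG' : G'.verts.Nonempty) : sccWPO D G hG = sccWPO D G' hG' := by
  subst h
  rfl

end TopDown

namespace DFForest

variable {V : Type*} {E : V → V → Prop} {D : DFForest V}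

/-- A loop body with more than one element has a back edge from another vertex into its head. -/
theorem exists_ne_isBack_of_mem_body {h v : V} (hv : v ∈ D.body E h) (hne : v ≠ h) :
    ∃ p, p ≠ h ∧ D.IsBack E p h := by
  replace hv := hv.2
  induction hv using Relation.ReflTransGen.head_induction_on with
  | refl => exact absurd rfl hne
  | @head a c hac _ ih =>
    by_cases hc : c = h
    · subst hc
      exact ⟨a, hne, hac.1, hac.2.1⟩
    · exact ih hc

theorem isBack_of_mem_body {h u : V} (hu : u ∈ D.body E h) (huh : E u h) : D.IsBack E u h :=
  ⟨huh, hu.1⟩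

theorem body_eq_singleton {h : V} (hh : ¬ ∃ p, D.IsBack E p h) : D.body E h = {h} := by
  refine Set.Subset.antisymm (fun v hv => ?_) (by simpa using mem_body_self h)
  by_contra hne
  obtain ⟨p, _, hp⟩ := exists_ne_isBack_of_mem_body hv hne
  exact hh ⟨p, hp⟩

theorem isLoopedHead_iff {h : V} : IsLoopedHead E D h ↔ E h h ∧ D.body E h ≠ {h} := by
  refine and_congr_right fun _ => ⟨?_, fun hne => ?_⟩
  · rintro ⟨p, hp, hb⟩ he
    exact hp (he ▸ mem_body_of_isBack hb : p ∈ ({h} : Set V))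
  · by_contra hno
    refine hne (Set.Subset.antisymm (fun v hv => ?_) (by simpa using mem_body_self h))
    by_contra hvh
    exact hno (exists_ne_isBack_of_mem_body hv hvh)

/-- The closed form of the result of `sccWPO` for the body of `h`. -/
structure IsResultOf (D : DFForest V) (E : V → V → Prop) (h : V) (R : SCCResult V) : Prop where
  exit : R.exit = D.exitOf E h
  verts : R.wpo.verts = Node.vtx '' D.body E h
  exits : ∀ a, a ∈ R.wpo.exits ↔ ∃ g ∈ D.body E h, (∃ p, D.IsBack E p g) ∧ a = Node.exit g
  stab : ∀ a b, R.wpo.stab a b ↔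
    ∃ g ∈ D.body E h, (∃ p, D.IsBack E p g) ∧ a = Node.exit g ∧ b = Node.vtx g
  sched : ∀ a b, R.wpo.sched a b ↔ ∃ g ∈ D.body E h, D.headSchedTD E g a b

/-- The closed form of the 4-tuple constructed from a graph at level `k`. -/
structure IsLevelTuple (D : DFForest V) (E : V → V → Prop) (G : NGraph V) (S : Set V) (k : ℕ)
    (W : WPOTuple V) : Prop where
  verts : W.verts = G.verts
  exits : ∀ a, a ∈ W.exits ↔ ∃ g ∈ S, (∃ p, D.IsBack E p g) ∧ a = Node.exit g
  stab : ∀ a b, W.stab a b ↔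
    ∃ g ∈ S, (∃ p, D.IsBack E p g) ∧ a = Node.exit g ∧ b = Node.vtx g
  sched : ∀ a b, W.sched a b ↔ (∃ g ∈ S, D.headSchedTD E g a b) ∨
    (∃ u ∈ S, ∃ v ∈ S, E u v ∧ D.repAt E k u ≠ D.repAt E k v ∧
      a = D.srcAt E k u ∧ b = Node.vtx v) ∨
    ∃ u ∈ S, ∃ x, Node.exit x ∈ G.verts ∧ G.edge (Node.vtx u) (Node.exit x) ∧
      a = D.srcAt E k u ∧ b = Node.exit x

/-- The components correspond to the self-representing vertices of `S` and to the exits. Two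
vertices lie in different components exactly if their representatives differ, and the exit of the
component of `u` is `srcAt k u`. -/
theorem IsLevel.connectTD {G : NGraph V} {S : Set V} {k : ℕ} (hG : D.IsLevel E G S k)
    (hD : D.IsDepthFirst E) {r : {C : Set (Node V) // G.IsMaxSCC C} → SCCResult V}
    (hbody : ∀ g ∈ S, D.repAt E k g = g → ∀ hC,
      D.IsResultOf E g (r ⟨Node.vtx '' D.body E g, hC⟩))
    (hexit : ∀ x hC, r ⟨{Node.exit x}, hC⟩ = trivialWPO (Node.exit x)) :
    D.IsLevelTuple E G S k (connectTD G r) := by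
  have hmax : ∀ v (_ : v ∈ S), G.IsMaxSCC (Node.vtx '' D.body E (D.repAt E k v)) := fun v hv =>
    hG.isMaxSCC_body hD (hG.body_sub v hv (mem_body_self _)) (hD.repAt_repAt k v)
  have hres : ∀ v (hv : v ∈ S), D.IsResultOf E (D.repAt E k v) (r ⟨_, hmax v hv⟩) := fun v hv =>
    hbody _ (hG.body_sub v hv (mem_body_self _)) (hD.repAt_repAt k v) _
  constructor
  · ext a
    constructor
    · rintro ⟨⟨C, hC⟩, ha⟩
      rcases hG.eq_of_isMaxSCC hD hC with ⟨g, hg, hgr, rfl⟩ | ⟨x, hx, rfl⟩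
      · rw [(hbody g hg hgr _).verts] at ha
        exact hC.1.1 ha
      · rw [hexit] at ha
        exact hC.1.1 ha
    · intro ha
      cases a with
      | vtx v =>
        have hv := (hG.vtx_mem v).1 ha
        refine ⟨⟨_, hmax v hv⟩, ?_⟩
        rw [(hres v hv).verts]
        exact ⟨v, mem_body_repAt k v, rfl⟩
      | exit x =>
        refine ⟨⟨_, hG.isMaxSCC_exit ha⟩, ?_⟩
        rw [hexit]
        rfl
  · intro a
    constructor
    · rintro ⟨⟨C, hC⟩, ha⟩
      rcases hG.eq_of_isMaxSCC hD hC with ⟨g, hg, hgr, rfl⟩ | ⟨x, hx, rfl⟩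
      · obtain ⟨g', hg', h⟩ := ((hbody g hg hgr _).exits a).1 ha
        exact ⟨g', (hG.vtx_mem g').1 (hC.1.1 ⟨g', hg', rfl⟩), h⟩
      · rw [hexit] at ha
        exact ha.elim
    · rintro ⟨g, hg, h⟩
      exact ⟨_, ((hres g hg).exits a).2 ⟨g, mem_body_repAt k g, h⟩⟩
  · intro a b
    constructor
    · rintro ⟨⟨C, hC⟩, ha⟩
      rcases hG.eq_of_isMaxSCC hD hC with ⟨g, hg, hgr, rfl⟩ | ⟨x, hx, rfl⟩
      · obtain ⟨g', hg', h⟩ := ((hbody g hg hgr _).stab a b).1 ha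
        exact ⟨g', (hG.vtx_mem g').1 (hC.1.1 ⟨g', hg', rfl⟩), h⟩
      · rw [hexit] at ha
        exact ha.elim
    · rintro ⟨g, hg, h⟩
      exact ⟨_, ((hres g hg).stab a b).2 ⟨g, mem_body_repAt k g, h⟩⟩
  · intro a b
    have hsrc : ∀ u (hu : u ∈ S), (r ⟨_, hmax u hu⟩).exit = D.srcAt E k u := by
      intro u hu
      rw [(hres u hu).exit, srcAt_of_le (hG.dfn_le u hu)]
    constructor
    · rintro (⟨⟨C, hC⟩, ha⟩ | ⟨⟨C, hC⟩, ⟨C', hC'⟩, c, hne, hcb, hc, hb, ha⟩)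
      · rcases hG.eq_of_isMaxSCC hD hC with ⟨g, hg, hgr, rfl⟩ | ⟨x, hx, rfl⟩
        · obtain ⟨g', hg', h⟩ := ((hbody g hg hgr _).sched a b).1 ha
          exact .inl ⟨g', (hG.vtx_mem g').1 (hC.1.1 ⟨g', hg', rfl⟩), h⟩
        · rw [hexit] at ha
          exact ha.elim
      · rcases hG.eq_of_isMaxSCC hD hC with ⟨g, hg, hgr, rfl⟩ | ⟨x, hx, rfl⟩
        swap
        · cases (show c = _ from hc)
          exact absurd hcb (hG.no_exit x b)
        obtain ⟨u, hu, rfl⟩ := hc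
        have huS := (hG.vtx_mem u).1 (hC.1.1 ⟨u, hu, rfl⟩)
        have hgu : D.repAt E k u = g := by
          rw [hD.repAt_eq_repAt hu (.inr (hG.dfn_le g hg)), hgr]
        subst hgu
        have ha' : a = D.srcAt E k u := ha.trans (hsrc u huS)
        rcases hG.eq_of_isMaxSCC hD hC' with ⟨g', hg', hgr', rfl⟩ | ⟨x, hx, rfl⟩
        · obtain ⟨v, hv, rfl⟩ := hb
          have hvS := (hG.vtx_mem v).1 (hC'.1.1 ⟨v, hv, rfl⟩)
          have hgv : D.repAt E k v = g' := by
            rw [hD.repAt_eq_repAt hv (.inr (hG.dfn_le g' hg')), hgr']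
          refine .inr (.inl ⟨u, huS, v, hvS, (hG.edge u huS v hvS).1 hcb, ?_, ha', rfl⟩)
          rintro h
          refine hne (Subtype.ext ?_)
          simp only [h, hgv]
        · cases (show b = _ from hb)
          exact .inr (.inr ⟨u, huS, x, hx, hcb, ha', rfl⟩)
    · rintro (⟨g, hg, h⟩ | ⟨u, hu, v, hv, huv, hne, rfl, rfl⟩ | ⟨u, hu, x, hx, hux, rfl, rfl⟩)
      · exact .inl ⟨_, ((hres g hg).sched a b).2 ⟨g, mem_body_repAt k g, h⟩⟩
      · refine .inr ⟨⟨_, hmax u hu⟩, ⟨_, hmax v hv⟩, Node.vtx u, ?_, (hG.edge u hu v hv).2 huv,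
          ⟨u, mem_body_repAt k u, rfl⟩, ⟨v, mem_body_repAt k v, rfl⟩, (hsrc u hu).symm⟩
        intro h
        have h1 : Node.vtx u ∈ Node.vtx '' D.body E (D.repAt E k v) := by
          rw [← show Node.vtx '' _ = Node.vtx '' _ from congrArg Subtype.val h]
          exact ⟨u, mem_body_repAt k u, rfl⟩
        obtain ⟨w, hw, hwu⟩ := h1
        cases hwu
        exact hne ((hD.mem_body_iff_repAt (hG.dfn_le v hv)).1 hw)
      · refine .inr ⟨⟨_, hmax u hu⟩, ⟨_, hG.isMaxSCC_exit hx⟩, Node.vtx u, ?_, hux,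
          ⟨u, mem_body_repAt k u, rfl⟩, rfl, (hsrc u hu).symm⟩
        intro h
        have h1 : Node.exit x ∈ Node.vtx '' D.body E (D.repAt E k u) := by
          rw [show Node.vtx '' _ = {Node.exit x} from congrArg Subtype.val h]
          rfl
        obtain ⟨w, _, hwu⟩ := h1
        cases hwu

theorem IsLevel.constructTD [Finite V] {G : NGraph V} {S : Set V} {k : ℕ}
    (hG : D.IsLevel E G S k) (hD : D.IsDepthFirst E)
    (hbody : ∀ g ∈ S, D.repAt E k g = g →
      D.IsResultOf E g (sccWPO D (D.bodyGraph E g) (bodyGraph_nonempty g))) :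
    D.IsLevelTuple E G S k (constructTD D G) := by
  rw [_root_.constructTD]
  refine hG.connectTD hD (fun g hg hgr hC => ?_) fun x hC => sccWPO_singleton_exit D G x _
  have hsub := hG.body_sub g hg
  rw [hgr] at hsub
  rw [sccWPO_congr (hG.restrict_body hsub) _ (bodyGraph_nonempty g)]
  exact hbody g hg hgr

theorem IsDepthFirst.minDFN_bodyGraph (hD : D.IsDepthFirst E) (h : V) :
    (D.bodyGraph E h).minDFN D (bodyGraph_nonempty h) = Node.vtx h := by
  have h1 := NGraph.minDFN_mem D (D.bodyGraph E h) (bodyGraph_nonempty h)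
  have h2 : D.nodeDFN ((D.bodyGraph E h).minDFN D (bodyGraph_nonempty h)) ≤
      D.nodeDFN (Node.vtx h) :=
    Function.argminOn_le D.nodeDFN _ (vtx_mem_bodyGraph.2 (mem_body_self h))
  rw [bodyGraph_verts] at h1
  obtain ⟨v, hv, hv'⟩ := h1
  rw [← hv'] at h2 ⊢
  have h3 : D.dfn v ≤ D.dfn h := by simpa [nodeDFN] using h2
  rw [hD.dfn_injective (le_antisymm h3 (hD.dfn_le hv.1))]

theorem headSchedTD_iff_of_not_isLoopedHead {g : V} {a b : Node V}
    (hg : ¬ IsLoopedHead E D g) : D.headSchedTD E g a b ↔ D.headSched E g a b := by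
  simp [headSchedTD, hg]

/-- The three alternatives follow the assembly in `extendTD`: edges between nested components, edges
redirected to the exit, edges out of `h`. A self-loop of `h` falls under the third and not the
second. -/
theorem IsDepthFirst.headSchedTD_iff (hD : D.IsDepthFirst E) {h : V} (hh : D.body E h ≠ {h})
    (a b : Node V) : D.headSchedTD E h a b ↔
      (∃ u ∈ D.body E h \ {h}, ∃ v ∈ D.body E h \ {h}, E u v ∧
        D.repAt E (D.dfn h + 1) u ≠ D.repAt E (D.dfn h + 1) v ∧
        a = D.srcAt E (D.dfn h + 1) u ∧ b = Node.vtx v) ∨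
      (∃ u ∈ D.body E h \ {h}, E u h ∧ a = D.srcAt E (D.dfn h + 1) u ∧ b = Node.exit h) ∨
      (a = Node.vtx h ∧ ∃ v ∈ D.body E h, E h v ∧ b = Node.vtx v) := by
  constructor
  · rintro (⟨⟨u, v, huv, hu, hv, hvh, hne, rfl, rfl⟩ | ⟨u, huh, hu, rfl, rfl⟩, hno⟩ |
      ⟨hl, rfl, rfl⟩)
    · by_cases huh : u = h
      · subst huh
        exact .inr (.inr ⟨hD.srcAt_succ_self u, v, hv, huv, rfl⟩)
      · exact .inl ⟨u, ⟨hu, huh⟩, v, ⟨hv, hvh⟩, huv, hne, rfl, rfl⟩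
    · by_cases he : u = h
      · subst he
        exact absurd ⟨isLoopedHead_iff.2 ⟨huh, hh⟩, hD.srcAt_succ_self u, rfl⟩ hno
      · exact .inr (.inl ⟨u, ⟨hu, he⟩, huh, rfl, rfl⟩)
    · exact .inr (.inr ⟨rfl, h, mem_body_self h, hl.1, rfl⟩)
  · rintro (⟨u, hu, v, hv, huv, hne, rfl, rfl⟩ | ⟨u, hu, huh, rfl, rfl⟩ |
      ⟨rfl, v, hv, hhv, rfl⟩)
    · exact .inl ⟨.inl ⟨u, v, huv, hu.1, hv.1, hv.2, hne, rfl, rfl⟩, by simp⟩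
    · refine .inl ⟨.inr ⟨u, huh, hu.1, rfl, rfl⟩, fun hno => hu.2 ?_⟩
      exact (hD.srcAt_succ_eq_vtx_iff hu.1).1 hno.2.1
    · by_cases hvh : v = h
      · subst hvh
        exact .inr ⟨isLoopedHead_iff.2 ⟨hhv, hh⟩, rfl, rfl⟩
      · refine .inl ⟨.inl ⟨h, v, hhv, mem_body_self h, hv, hvh, ?_, (hD.srcAt_succ_self h).symm,
          rfl⟩, by simp⟩
        rw [hD.repAt_succ_self]
        exact (hD.repAt_mem_body hv hvh).2.symm

theorem IsDepthFirst.isResultOf_sccWPO [Finite V] (hD : D.IsDepthFirst E) (h : V) :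
    D.IsResultOf E h (sccWPO D (D.bodyGraph E h) (bodyGraph_nonempty h)) := by
  classical
  induction hn : (D.body E h).ncard using Nat.strong_induction_on generalizing h with
  | _ n ih =>
  subst hn
  rw [sccWPO_of_minDFN_vtx D _ _ (hD.minDFN_bodyGraph h)]
  have hedge : (∃ v ∈ (D.bodyGraph E h).verts, (D.bodyGraph E h).edge v (Node.vtx h)) ↔
      ∃ p, D.IsBack E p h := by
    constructor
    · rintro ⟨a, _, ha⟩
      obtain ⟨u, v, rfl, hv, huv, hu, _⟩ := exists_of_bodyGraph_edge ha
      cases hv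
      exact ⟨u, huv, hu.1⟩
    · rintro ⟨p, hp⟩
      have := mem_body_of_isBack hp
      exact ⟨Node.vtx p, vtx_mem_bodyGraph.2 this,
        bodyGraph_edge.2 ⟨hp.1, this, mem_body_self h⟩⟩
  have hcard : (D.bodyGraph E h).verts.ncard = 1 ↔ D.body E h = {h} := by
    rw [bodyGraph_verts, Set.ncard_image_of_injective _ (fun a b hab => by cases hab; rfl),
      Set.ncard_eq_one]
    constructor
    · rintro ⟨a, ha⟩
      have : h ∈ ({a} : Set V) := ha ▸ mem_body_self h
      rw [ha, Set.mem_singleton_iff.1 this]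
    · exact fun he => ⟨h, he⟩
  rw [hedge]
  split_ifs with hback hone
  -- The case without edges into `h` is taken first.
  rotate_right 1
  · have hs := body_eq_singleton hback
    refine ⟨(if_neg hback).symm, by simp [trivialWPO, hs], ?_, ?_, ?_⟩
    · simp [trivialWPO, hs, hback]
    · simp [trivialWPO, hs, hback]
    · intro a b
      simp only [trivialWPO, false_iff, hs, Set.mem_singleton_iff, exists_eq_left]
      rw [headSchedTD_iff_of_not_isLoopedHead (by simp [isLoopedHead_iff, hs])]
      rintro (⟨u, v, huv, hu, hv, hvh, _⟩ | ⟨u, huh, hu, _⟩)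
      · rw [hs] at hv
        exact hvh hv
      · exact hback ⟨u, huh, hu.1⟩
  · have hback := hback
    have hs := hcard.1 hone
    refine ⟨(if_pos hback).symm, by simp [selfLoopWPO, hs], ?_, ?_, ?_⟩
    · simp [selfLoopWPO, hs, hback]
    · simp [selfLoopWPO, hs, hback]
    · intro a b
      simp only [selfLoopWPO, hs, Set.mem_singleton_iff, exists_eq_left]
      rw [headSchedTD_iff_of_not_isLoopedHead (by simp [isLoopedHead_iff, hs])]
      constructor
      · rintro ⟨rfl, rfl⟩
        obtain ⟨p, hp⟩ := hback
        have hp' := mem_body_of_isBack hp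
        have : p = h := by rwa [hs] at hp'
        subst this
        exact .inr ⟨p, hp.1, mem_body_self p, (hD.srcAt_succ_self p).symm, rfl⟩
      · rintro (⟨u, v, huv, hu, hv, hvh, _⟩ | ⟨u, huh, hu, rfl, rfl⟩)
        · rw [hs] at hv
          exact absurd hv hvh
        · have : u = h := by rwa [hs] at hu
          subst this
          exact ⟨hD.srcAt_succ_self u, rfl⟩
  · have hback := hback
    have hne : D.body E h ≠ {h} := fun he => hone (hcard.2 he)
    -- The body of a nested head omits `h`, so it is strictly smaller and the induction hypothesis
    -- applies.
    have hW := (hD.isLevel_breakHead h).constructTD hD fun g hg _ => by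
      refine ih _ (Set.ncard_lt_ncard ?_ (Set.toFinite _)) g rfl
      refine ⟨body_subset hg.1, fun hsub => ?_⟩
      have h1 := hD.dfn_le (hsub (mem_body_self h)).1
      have h2 := hD.dfn_lt hg.1.1 (Ne.symm hg.2)
      omega
    have hsplit : ∀ p : V → Prop, (∃ g ∈ D.body E h, p g) ↔
        (∃ g ∈ D.body E h \ {h}, p g) ∨ p h := by
      intro p
      constructor
      · rintro ⟨g, hg, hp⟩
        by_cases he : g = h
        · exact .inr (he ▸ hp)
        · exact .inl ⟨g, ⟨hg, he⟩, hp⟩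
      · rintro (⟨g, hg, hp⟩ | hp)
        · exact ⟨g, hg.1, hp⟩
        · exact ⟨h, mem_body_self h, hp⟩
    refine ⟨(if_pos hback).symm, bodyGraph_verts h, ?_, ?_, ?_⟩
    · intro a
      simp only [extendTD, Set.mem_union, hW.exits, Set.mem_singleton_iff]
      rw [hsplit, and_iff_right hback]
    · intro a b
      simp only [extendTD, hW.stab]
      rw [hsplit, and_iff_right hback]
    · intro a b
      simp only [extendTD, hW.sched]
      rw [hsplit, or_assoc, hD.headSchedTD_iff hne, or_assoc]
      refine or_congr_right (or_congr_right (or_congr ?_ ?_))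
      · constructor
        · rintro ⟨u, hu, x, _, hux, ha, hb⟩
          rcases hux with ⟨h1, _⟩ | ⟨_, h1, h2⟩
          · obtain ⟨_, _, _, h2, _⟩ := exists_of_bodyGraph_edge h1
            cases h2
          · cases h2
            exact ⟨u, hu, (bodyGraph_edge.1 h1).1, ha, hb⟩
        · rintro ⟨u, hu, huh, ha, hb⟩
          refine ⟨u, hu, h, by simp [NGraph.breakHead], .inr ⟨vtx_mem_bodyGraph.2 hu.1,
            bodyGraph_edge.2 ⟨huh, hu.1, mem_body_self h⟩, rfl⟩, ha, hb⟩
      · refine and_congr_right fun _ => ⟨?_, ?_⟩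
        · rintro ⟨_, hb⟩
          obtain ⟨u, v, hu, rfl, huv, _, hv⟩ := exists_of_bodyGraph_edge hb
          cases hu
          exact ⟨v, hv, huv, rfl⟩
        · rintro ⟨v, hv, hhv, rfl⟩
          exact ⟨vtx_mem_bodyGraph.2 hv, bodyGraph_edge.2 ⟨hhv, mem_body_self h, hv⟩⟩

theorem IsDepthFirst.constructWPOTD [Finite V] (hD : D.IsDepthFirst E) :
    D.IsLevelTuple E (NGraph.ofRel E) Set.univ 0 (ConstructWPOTD E D) :=
  isLevel_ofRel.constructTD hD fun g _ _ => hD.isResultOf_sccWPO g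

-- When edges are restored and where they are recorded

/-- The cross and forward edges with lowest common ancestor `a`. -/
def crossAt (D : DFForest V) (E : V → V → Prop) (a : Option V) : Set (V × V) :=
  {e | D.IsCrossFwd E e.1 e.2 ∧
    match a with
    | some h => D.IsLCA h e.1 e.2
    | none => ¬ ∃ b, D.Anc b e.1 ∧ D.Anc b e.2}

/-- All heads with depth-first number at least `lvl a` have been processed when the edges stored
at `a` are restored. -/
noncomputable def lvl (D : DFForest V) : Option V → ℕ
  | none => 0
  | some a => D.dfn a + 1

/-- The pair `(u, v)` is recorded in `O[w]` when the edges stored at vertices of level at least `j`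
have been restored. -/
def RecordedAt (D : DFForest V) (E : V → V → Prop) (j : ℕ) (w u v : V) : Prop :=
  (D.parent v = some u ∧ w = v) ∨
  ∃ a, (u, v) ∈ D.crossAt E a ∧ j ≤ D.lvl a ∧ w = D.repAt E (D.lvl a) v

theorem IsDepthFirst.not_isBack_of_parent (hD : D.IsDepthFirst E) {u v : V}
    (huv : D.parent v = some u) : ¬ D.IsBack E u v := fun h =>
  absurd (hD.dfn_le h.2) (not_le.2 (hD.dfn_parent huv))

theorem IsDepthFirst.edge_not_isCrossFwd_iff (hD : D.IsDepthFirst E) {u v : V} :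
    E u v ∧ ¬ D.IsCrossFwd E u v ↔ D.parent v = some u ∨ D.IsBack E u v := by
  constructor
  · rintro ⟨huv, h⟩
    by_contra hno
    exact h ⟨huv, fun hp => hno (.inl hp), fun ha => hno (.inr ⟨huv, ha⟩)⟩
  · rintro (h | h)
    · exact ⟨hD.edge_of_parent h, fun hc => hc.2.1 h⟩
    · exact ⟨h.1, fun hc => hc.2.2 h.2⟩

theorem IsDepthFirst.depth_lt [Finite V] (hD : D.IsDepthFirst E) {a b : V} (hab : D.Anc a b)
    (hne : a ≠ b) : D.depth a < D.depth b := by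
  refine Set.ncard_lt_ncard ⟨fun c hc => Anc.trans hc hab, fun hsub => ?_⟩ (Set.toFinite _)
  have : D.Anc b a := hsub (show D.Anc b b from .refl)
  exact absurd (hD.dfn_le this) (not_le.2 (hD.dfn_lt hab hne))

theorem IsDepthFirst.anc_of_isLCA [Finite V] (hD : D.IsDepthFirst E) {a b u v : V}
    (ha : D.IsLCA a u v) (hu : D.Anc b u) (hv : D.Anc b v) : D.Anc b a := by
  rcases hu.total ha.1 with h | h
  · exact h
  · by_cases he : a = b
    · subst he
      exact .refl
    · exact absurd (ha.2.2 b hu hv) (not_le.2 (hD.depth_lt h he))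

theorem exists_isLCA [Finite V] {b u v : V} (hu : D.Anc b u) (hv : D.Anc b v) :
    ∃ a, D.IsLCA a u v := by
  obtain ⟨a, ha, hmax⟩ := Set.exists_max_image {a | D.Anc a u ∧ D.Anc a v} D.depth
    (Set.toFinite _) ⟨b, hu, hv⟩
  exact ⟨a, ha.1, ha.2, fun c hc hc' => hmax c ⟨hc, hc'⟩⟩

theorem exists_mem_crossAt [Finite V] {u v : V} (huv : D.IsCrossFwd E u v) :
    ∃ a, (u, v) ∈ D.crossAt E a := by
  by_cases h : ∃ b, D.Anc b u ∧ D.Anc b v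
  · obtain ⟨b, hu, hv⟩ := h
    obtain ⟨a, ha⟩ := exists_isLCA hu hv
    exact ⟨some a, huv, ha⟩
  · exact ⟨none, huv, h⟩

/-- A common ancestor `b` is an ancestor of the lowest one. As heads are processed in descending
order, the edge is already restored when `b` is searched. -/
theorem IsDepthFirst.lt_lvl_of_mem_crossAt [Finite V] (hD : D.IsDepthFirst E) {u v b : V}
    {a : Option V} (ha : (u, v) ∈ D.crossAt E a) (hu : D.Anc b u) (hv : D.Anc b v) :
    D.dfn b + 1 ≤ D.lvl a := by
  cases a with
  | none => exact absurd ⟨b, hu, hv⟩ ha.2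
  | some a => exact Nat.succ_le_succ (hD.dfn_le (hD.anc_of_isLCA ha.2 hu hv))

/-- Conversely, `b` and the lowest common ancestor are both above `v`, and the order of their
numbers puts `b` on top. -/
theorem IsDepthFirst.anc_of_le_lvl (hD : D.IsDepthFirst E) {u v b : V}
    {a : Option V} (ha : (u, v) ∈ D.crossAt E a) (hv : D.Anc b v) (hb : D.dfn b + 1 ≤ D.lvl a) :
    D.Anc b u := by
  cases a with
  | none => simp [lvl] at hb
  | some a => exact (hD.anc_of_dfn_le hv ha.2.2.1 (Nat.le_of_succ_le_succ hb)).trans ha.2.1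

theorem IsDepthFirst.edge_of_recordedAt (hD : D.IsDepthFirst E) {j : ℕ} {w u v : V}
    (h : D.RecordedAt E j w u v) : E u v := by
  rcases h with ⟨h, _⟩ | ⟨a, ha, _⟩
  · exact hD.edge_of_parent h
  · exact ha.1.1

theorem mem_body_of_recordedAt {j : ℕ} {w u v : V} (h : D.RecordedAt E j w u v) :
    v ∈ D.body E w := by
  rcases h with ⟨_, rfl⟩ | ⟨a, _, _, rfl⟩
  · exact mem_body_self _
  · exact mem_body_repAt _ _

/-- The sources of the recorded edges lie outside the subtree of the head. -/
theorem IsDepthFirst.not_anc_of_recordedAt [Finite V] (hD : D.IsDepthFirst E) {j : ℕ} {w u v : V}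
    (h : D.RecordedAt E j w u v) : ¬ D.Anc w u := by
  rcases h with ⟨h, rfl⟩ | ⟨a, ha, _, rfl⟩
  · exact fun hanc => absurd (hD.dfn_le hanc) (not_le.2 (hD.dfn_parent h))
  · intro hanc
    have h1 := hD.lt_lvl_of_mem_crossAt ha hanc (anc_repAt _ _)
    rcases D.repAt_eq_or_le (E := E) (D.lvl a) v with h2 | h2
    · rw [h2] at hanc
      exact ha.1.2.2 hanc
    · omega

theorem IsDepthFirst.repAt_of_recordedAt (hD : D.IsDepthFirst E) {k : ℕ} {r u v : V}
    (hr : D.repAt E k r = r) (h : D.RecordedAt E k r u v) : D.repAt E k v = r := by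
  rcases h with ⟨h, rfl⟩ | ⟨a, ha, hk, rfl⟩
  · exact hr
  · rw [hD.repAt_eq_repAt (mem_body_repAt (D.lvl a) v), hr]
    exact (repAt_eq_or_le _ _).imp_right hk.trans

/-- All edges between different classes are recorded at the representative of their target. -/
theorem IsDepthFirst.recordedAt_repAt [Finite V] (hD : D.IsDepthFirst E) {k : ℕ} {u v : V}
    (huv : E u v) (hk : k ≤ D.dfn v) (hne : D.repAt E k u ≠ D.repAt E k v)
    (hlvl : ∀ a, (u, v) ∈ D.crossAt E a → k ≤ D.lvl a) :
    D.RecordedAt E k (D.repAt E k v) u v := by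
  have hnot := hD.not_anc_repAt huv hk hne
  by_cases hp : D.parent v = some u
  · refine .inl ⟨hp, ?_⟩
    by_contra hrv
    exact hnot ((anc_repAt k v).parent hrv hp)
  · obtain ⟨a, ha⟩ := exists_mem_crossAt (D := D) (E := E)
      ⟨huv, hp, fun h => hnot ((anc_repAt k v).trans h)⟩
    -- The representative of `v` has not changed since the edge was restored: a head processed later
    -- would be an ancestor of `u` too.
    refine .inr ⟨a, ha, hlvl a ha, (hD.repAt_mono rfl (hlvl a ha) (.inr ?_)).symm⟩
    by_contra hlt
    refine hnot (hD.anc_of_le_lvl ha (anc_repAt k v) (by omega))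

theorem IsDepthFirst.mem_body_of_recordedAt_succ (hD : D.IsDepthFirst E) {h r u v : V}
    (hr : r ∈ D.body E h) (hne : r ≠ h) (hrec : D.RecordedAt E (D.dfn h + 1) r u v) :
    u ∈ D.body E h ∧ v ∈ D.body E h := by
  have hv : v ∈ D.body E h := body_subset hr (mem_body_of_recordedAt hrec)
  refine ⟨mem_body_of_edge hv (hD.edge_of_recordedAt hrec) ?_, hv⟩
  rcases hrec with ⟨hp, rfl⟩ | ⟨a, ha, hk, _⟩
  · exact hr.1.parent hne.symm hp
  · exact hD.anc_of_le_lvl ha hv.1 hk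

theorem IsDepthFirst.recordedAt_of_mem_body [Finite V] (hD : D.IsDepthFirst E) {h u v : V}
    (huv : E u v) (hu : u ∈ D.body E h) (hv : v ∈ D.body E h) (hvh : v ≠ h)
    (hne : D.repAt E (D.dfn h + 1) u ≠ D.repAt E (D.dfn h + 1) v) :
    D.RecordedAt E (D.dfn h + 1) (D.repAt E (D.dfn h + 1) v) u v :=
  hD.recordedAt_repAt huv (hD.dfn_lt hv.1 hvh.symm) hne fun _ ha =>
    hD.lt_lvl_of_mem_crossAt ha hu.1 hv.1

/-- The state of the bottom-up construction when the edges stored at vertices of level at least `j`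
have been restored and the heads with depth-first number at least `k` have been processed. -/
noncomputable def buState (D : DFForest V) (E : V → V → Prop) (j k : ℕ) : BUState V where
  edge u w := D.IsBack E u w ∨ ∃ v, D.RecordedAt E j w u v
  exits := {a | ∃ g, k ≤ D.dfn g ∧ (∃ p, D.IsBack E p g) ∧ a = Node.exit g}
  sched a b := ∃ g, k ≤ D.dfn g ∧ D.headSched E g a b
  stab a b := ∃ g, k ≤ D.dfn g ∧ (∃ p, D.IsBack E p g) ∧ a = Node.exit g ∧ b = Node.vtx g
  rep := D.repAt E k
  exit := D.exitAt E k
  R := D.crossAt E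
  O w := {e | D.RecordedAt E j w e.1 e.2}

theorem IsDepthFirst.dfn_lt_length (hD : D.IsDepthFirst E) (v : V) :
    D.dfn v < D.order.length := by
  classical
  exact List.idxOf_lt_length_iff.2 (hD.mem v)

theorem IsDepthFirst.lvl_le_length (hD : D.IsDepthFirst E) (a : Option V) :
    D.lvl a ≤ D.order.length := by
  cases a with
  | none => exact Nat.zero_le _
  | some a => exact hD.dfn_lt_length a

/-- Levels are at most the length of the order, so `j` one larger means that nothing is restored;
numbers are below the length, so no head is processed. -/
theorem IsDepthFirst.init_eq (hD : D.IsDepthFirst E) :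
    BUState.init E D = D.buState E (D.order.length + 1) D.order.length := by
  have hlt : ∀ v, ¬ D.order.length ≤ D.dfn v := fun v => not_le.2 (hD.dfn_lt_length v)
  have hrec : ∀ w u v, D.RecordedAt E (D.order.length + 1) w u v ↔
      D.parent v = some u ∧ w = v := by
    intro w u v
    refine or_iff_left ?_
    rintro ⟨a, _, ha, _⟩
    have := hD.lvl_le_length a
    omega
  simp only [BUState.init, BUState.removeAllCrossForwardEdges, BUState.start, buState,
    BUState.mk.injEq, hrec, hlt, false_and, exists_false, Set.empty_union]
  refine ⟨?_, rfl, trivial, trivial, ?_, ?_, rfl, ?_⟩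
  · funext u w
    refine propext (hD.edge_not_isCrossFwd_iff.trans ?_)
    simp [or_comm]
  · funext v
    exact (hD.repAt_of_lt (hD.dfn_lt_length v)).symm
  · funext v
    exact (if_neg (hlt v)).symm
  · funext w
    ext ⟨u, v⟩
    constructor
    · rintro ⟨rfl, h1, h2⟩
      exact ⟨(hD.edge_not_isCrossFwd_iff.1 h1).resolve_right h2, rfl⟩
    · rintro ⟨h, rfl⟩
      exact ⟨rfl, hD.edge_not_isCrossFwd_iff.2 (.inl h), hD.not_isBack_of_parent h⟩

theorem IsDepthFirst.lvl_injective (hD : D.IsDepthFirst E) : Function.Injective D.lvl := by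
  intro a b hab
  cases a <;> cases b <;> simp [lvl] at hab ⊢
  exact hD.dfn_injective hab

/-- Levels are injective, so lowering `j` by one adds just the edges stored at `a`; as `k` equals
the level of `a`, they are attached to the representatives used in `RecordedAt`. -/
theorem IsDepthFirst.restore_buState (hD : D.IsDepthFirst E) (a : Option V) :
    (D.buState E (D.lvl a + 1) (D.lvl a)).restoreCrossForwardEdges a =
      D.buState E (D.lvl a) (D.lvl a) := by
  have hrec : ∀ w u v, D.RecordedAt E (D.lvl a) w u v ↔ D.RecordedAt E (D.lvl a + 1) w u v ∨
      (u, v) ∈ D.crossAt E a ∧ w = D.repAt E (D.lvl a) v := by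
    intro w u v
    constructor
    · rintro (h | ⟨b, hb, hle, hw⟩)
      · exact .inl (.inl h)
      · rcases hle.eq_or_lt with he | hlt
        · cases hD.lvl_injective he
          exact .inr ⟨hb, hw⟩
        · exact .inl (.inr ⟨b, hb, hlt, hw⟩)
    · rintro ((h | ⟨b, hb, hle, hw⟩) | ⟨h, hw⟩)
      · exact .inl h
      · exact .inr ⟨b, hb, Nat.le_of_succ_le hle, hw⟩
      · exact .inr ⟨a, h, le_rfl, hw⟩
  simp only [BUState.restoreCrossForwardEdges, buState, BUState.mk.injEq, true_and]
  constructor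
  · funext u w
    simp only [hrec, exists_or, or_assoc]
  · funext w
    ext ⟨u, v⟩
    refine (or_congr_right (and_congr_right fun _ => eq_comm)).trans (hrec w u v).symm

/-- The representatives of the components nested in the component with head `h`. -/
def nestedReps (D : DFForest V) (E : V → V → Prop) (h : V) : Set V :=
  {r | ∃ v ∈ D.body E h, v ≠ h ∧ r = D.repAt E (D.dfn h + 1) v}

end DFForest

-- The worklist search and the nested components

namespace BUState

variable {V : Type*} {E : V → V → Prop} {D : DFForest V} {h : V} {s : BUState V}

/-- The representatives that are put on the worklist for `v`. -/
def preds (E : V → V → Prop) (D : DFForest V) (s : BUState V) (v : V) : Set V :=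
  {q | ∃ p, s.edge p v ∧ ¬ D.IsBack E p v ∧ q = s.rep p}

/-- The final `N` is the least set that contains the initial worklist and is closed under `preds` up
to `h`, hence independent of all choices. The invariant concerns the union of worklist and `N`. -/
theorem SearchStep.result {W₀ N : Set V}
    (hrun : Relation.ReflTransGen (SearchStep E D h s) (W₀, ∅) (∅, N)) :
    W₀ ⊆ N ∧ (∀ v ∈ N, s.preds E D v ⊆ N ∪ {h}) ∧
      ∀ M, W₀ ⊆ M → (∀ v ∈ M, s.preds E D v ⊆ M ∪ {h}) → N ⊆ M := by
  have key : ∀ c : Set V × Set V, Relation.ReflTransGen (SearchStep E D h s) (W₀, ∅) c →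
      W₀ ⊆ c.1 ∪ c.2 ∧ (∀ v ∈ c.2, s.preds E D v ⊆ c.1 ∪ c.2 ∪ {h}) ∧
      ∀ M, W₀ ⊆ M → (∀ v ∈ M, s.preds E D v ⊆ M ∪ {h}) → c.1 ∪ c.2 ⊆ M := by
    intro c hc
    induction hc with
    | refl => exact ⟨by simp, by simp, fun M hM _ => by simpa using hM⟩
    | tail _ hstep ih =>
      obtain ⟨W, N, v, hv⟩ := hstep
      obtain ⟨h1, h2, h3⟩ := ih
      have hsub : W ∪ N ⊆ (W \ {v}) ∪ {q | ∃ p, s.edge p v ∧ ¬ D.IsBack E p v ∧ q = s.rep p ∧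
            q ∉ (N ∪ {v}) ∪ {h} ∪ (W \ {v})} ∪ (N ∪ {v}) := by
        rintro x (hx | hx)
        · by_cases hxv : x = v
          · exact .inr (.inr hxv)
          · exact .inl (.inl ⟨hx, hxv⟩)
        · exact .inr (.inl hx)
      refine ⟨h1.trans hsub, ?_, ?_⟩
      · rintro w (hw | rfl)
        · exact (h2 w hw).trans (Set.union_subset_union_left _ hsub)
        · rintro q ⟨p, hp, hb, hq⟩
          by_cases hmem : q ∈ (N ∪ {w}) ∪ {h} ∪ (W \ {w})
          · rcases hmem with (hmem | hmem) | hmem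
            · exact .inl (.inr hmem)
            · exact .inr hmem
            · exact .inl (.inl (.inl hmem))
          · exact .inl (.inl (.inr ⟨p, hp, hb, hq, hmem⟩))
      · intro M hM hcl
        have h4 := h3 M hM hcl
        rintro x ((hx | ⟨p, hp, hb, hq, hmem⟩) | (hx | hx))
        · exact h4 (.inl hx.1)
        · rcases hcl v (h4 (.inl hv)) ⟨p, hp, hb, hq⟩ with hx | hx
          · exact hx
          · exact absurd (.inl (.inr hx)) hmem
        · exact h4 (.inr hx)
        · exact h4 (.inl ((show x = v from hx) ▸ hv))
  simpa using key _ hrun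

/-- The worklist stays disjoint from `N`, so each round enlarges `N` and the finite complement
shrinks. -/
theorem SearchStep.exists_result [Finite V] (W N : Set V) (hWN : Disjoint W N) :
    ∃ N', Relation.ReflTransGen (SearchStep E D h s) (W, N) (∅, N') := by
  induction hn : (Nᶜ).ncard using Nat.strong_induction_on generalizing W N with
  | _ n ih =>
  subst hn
  rcases W.eq_empty_or_nonempty with rfl | ⟨v, hv⟩
  · exact ⟨N, .refl⟩
  · have hvN : v ∉ N := Set.disjoint_left.1 hWN hv
    have hdisj : Disjoint ((W \ {v}) ∪ {q | ∃ p, s.edge p v ∧ ¬ D.IsBack E p v ∧ q = s.rep p ∧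
        q ∉ (N ∪ {v}) ∪ {h} ∪ (W \ {v})}) (N ∪ {v}) := by
      rw [Set.disjoint_left]
      rintro x (hx | ⟨_, _, _, _, hx⟩) hx'
      · rcases hx' with hx' | hx'
        · exact Set.disjoint_left.1 hWN hx.1 hx'
        · exact hx.2 hx'
      · exact hx (.inl (.inl hx'))
    have hlt : ((N ∪ {v})ᶜ).ncard < (Nᶜ).ncard := Set.ncard_lt_ncard
      ⟨Set.compl_subset_compl.2 Set.subset_union_left, fun hsub => hsub hvN (.inr rfl)⟩
      (Set.toFinite _)
    obtain ⟨N', hN'⟩ := ih _ hlt _ _ hdisj rfl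
    exact ⟨N', .head (.pop W N v hv) hN'⟩

end BUState

namespace DFForest

variable {V : Type*} {E : V → V → Prop} {D : DFForest V} [Finite V]

theorem IsDepthFirst.preds_buState (hD : D.IsDepthFirst E) {h r : V} :
    (D.buState E (D.dfn h + 1) (D.dfn h + 1)).preds E D r =
      {q | ∃ u v, D.RecordedAt E (D.dfn h + 1) r u v ∧ q = D.repAt E (D.dfn h + 1) u} := by
  ext q
  constructor
  · rintro ⟨u, hb | ⟨v, hv⟩, hnb, rfl⟩
    · exact absurd hb hnb
    · exact ⟨u, v, hv, rfl⟩
  · rintro ⟨u, v, hv, rfl⟩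
    exact ⟨u, .inr ⟨v, hv⟩, fun hb => hD.not_anc_of_recordedAt hv hb.2, rfl⟩

theorem IsDepthFirst.nestedReps_closed (hD : D.IsDepthFirst E) {h r : V}
    (hr : r ∈ D.nestedReps E h) :
    (D.buState E (D.dfn h + 1) (D.dfn h + 1)).preds E D r ⊆ D.nestedReps E h ∪ {h} := by
  rw [hD.preds_buState]
  rintro q ⟨u, v, huv, rfl⟩
  obtain ⟨w, hw, hwh, rfl⟩ := hr
  have h1 := hD.repAt_mem_body hw hwh
  by_cases huh : u = h
  · subst huh
    exact .inr (hD.repAt_succ_self u)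
  · exact .inl ⟨u, (hD.mem_body_of_recordedAt_succ h1.1 h1.2 huv).1, huh, rfl⟩

/-- Along a path to `h` inside the body, traversed backwards, the last vertex before `h` is the
source of a back edge. Every earlier vertex either shares the class of its successor or is one of
the predecessors of that class. -/
theorem IsDepthFirst.nestedReps_subset (hD : D.IsDepthFirst E) {h : V} {N : Set V}
    (hN : (D.buState E (D.dfn h + 1) (D.dfn h + 1)).backReps E D h \ {h} ⊆ N)
    (hcl : ∀ v ∈ N,
      (D.buState E (D.dfn h + 1) (D.dfn h + 1)).preds E D v ⊆ N ∪ {h}) :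
    D.nestedReps E h ⊆ N := by
  have key : ∀ v, Relation.ReflTransGen (fun a b => E a b ∧ a ∈ D.body E h ∧ b ∈ D.body E h) v h →
      v ∈ D.body E h → v ≠ h → D.repAt E (D.dfn h + 1) v ∈ N := by
    intro v hv
    induction hv using Relation.ReflTransGen.head_induction_on with
    | refl => exact fun _ hne => absurd rfl hne
    | @head a c hac _ ih =>
      intro ha hah
      have h1 := hD.repAt_mem_body ha hah
      by_cases hch : c = h
      · subst hch
        exact hN ⟨⟨a, isBack_of_mem_body ha hac.1, rfl⟩, h1.2⟩
      · have hc := ih hac.2.2 hch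
        by_cases he : D.repAt E (D.dfn h + 1) a = D.repAt E (D.dfn h + 1) c
        · rwa [he]
        · have h2 : D.repAt E (D.dfn h + 1) a ∈
              (D.buState E (D.dfn h + 1) (D.dfn h + 1)).preds E D
                (D.repAt E (D.dfn h + 1) c) := by
            rw [hD.preds_buState]
            exact ⟨a, c, hD.recordedAt_of_mem_body hac.1 ha hac.2.2 hch he, rfl⟩
          exact (hcl _ hc h2).resolve_right h1.2
  rintro _ ⟨v, hv, hvh, rfl⟩
  exact key v (hD.reachable_of_mem_body hv (mem_body_self h)) hv hvh

theorem IsDepthFirst.findNestedSCCs_iff (hD : D.IsDepthFirst E) {h : V} {N P : Set V} :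
    BUState.FindNestedSCCs E D h (D.buState E (D.dfn h + 1) (D.dfn h + 1)) N P ↔
      N = D.nestedReps E h ∧
        P = (D.buState E (D.dfn h + 1) (D.dfn h + 1)).backReps E D h := by
  have huniq : ∀ N, Relation.ReflTransGen
      (BUState.SearchStep E D h (D.buState E (D.dfn h + 1) (D.dfn h + 1)))
      ((D.buState E (D.dfn h + 1) (D.dfn h + 1)).backReps E D h \ {h}, ∅) (∅, N) →
      N = D.nestedReps E h := by
    intro N hN
    obtain ⟨h1, h2, h3⟩ := BUState.SearchStep.result hN
    refine Set.Subset.antisymm (h3 _ ?_ fun r hr => hD.nestedReps_closed hr)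
      (hD.nestedReps_subset h1 h2)
    rintro _ ⟨⟨p, hp, rfl⟩, hne⟩
    refine ⟨p, mem_body_of_isBack hp, ?_, rfl⟩
    rintro rfl
    exact hne (hD.repAt_succ_self p)
  constructor
  · rintro ⟨rfl, hN⟩
    exact ⟨huniq N hN, rfl⟩
  · rintro ⟨rfl, rfl⟩
    refine ⟨rfl, ?_⟩
    obtain ⟨N, hN⟩ := BUState.SearchStep.exists_result (E := E) (D := D) (h := h)
      (s := D.buState E (D.dfn h + 1) (D.dfn h + 1))
      ((D.buState E (D.dfn h + 1) (D.dfn h + 1)).backReps E D h \ {h}) ∅ (Set.disjoint_empty _)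
    rwa [huniq N hN] at hN

end DFForest

-- Closed form of the bottom-up construction

namespace DFForest

variable {V : Type*} {E : V → V → Prop} {D : DFForest V}

theorem newSched_buState {k : ℕ} {w : V} {a b : Node V} :
    (D.buState E k k).newSched E D false w a b ↔
      ∃ u v, D.RecordedAt E k w u v ∧ a = D.srcAt E k u ∧ b = Node.vtx v :=
  or_iff_left fun h => Bool.false_ne_true h.1

theorem IsDepthFirst.mem_nestedReps_iff (hD : D.IsDepthFirst E) {h r : V} :
    r ∈ D.nestedReps E h ↔ r ∈ D.body E h ∧ r ≠ h ∧ D.repAt E (D.dfn h + 1) r = r := by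
  constructor
  · rintro ⟨v, hv, hvh, rfl⟩
    exact ⟨(hD.repAt_mem_body hv hvh).1, (hD.repAt_mem_body hv hvh).2, hD.repAt_repAt _ _⟩
  · rintro ⟨hr, hne, he⟩
    exact ⟨r, hr, hne, he.symm⟩

theorem IsDepthFirst.dfn_le_iff (hD : D.IsDepthFirst E) {g h : V} :
    D.dfn h ≤ D.dfn g ↔ D.dfn h + 1 ≤ D.dfn g ∨ g = h := by
  rw [Nat.le_iff_lt_or_eq]
  exact or_congr_right ⟨fun he => (hD.dfn_injective he).symm, fun he => by rw [he]⟩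

theorem IsDepthFirst.newSched_iff_headSched [Finite V] (hD : D.IsDepthFirst E) {h : V}
    {a b : Node V} :
    (∃ r ∈ D.nestedReps E h,
      (D.buState E (D.dfn h + 1) (D.dfn h + 1)).newSched E D false r a b) ∨
    (∃ q ∈ (D.buState E (D.dfn h + 1) (D.dfn h + 1)).backReps E D h,
      a = D.srcAt E (D.dfn h + 1) q ∧ b = Node.exit h) ↔ D.headSched E h a b := by
  refine or_congr ?_ ?_
  · constructor
    · rintro ⟨r, hr, hs⟩
      obtain ⟨u, v, huv, ha, hb⟩ := newSched_buState.1 hs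
      obtain ⟨hr, hrh, hrr⟩ := hD.mem_nestedReps_iff.1 hr
      obtain ⟨hu, hv⟩ := hD.mem_body_of_recordedAt_succ hr hrh huv
      have hvr := hD.repAt_of_recordedAt hrr huv
      refine ⟨u, v, hD.edge_of_recordedAt huv, hu, hv, ?_, ?_, ha, hb⟩
      · rintro rfl
        exact hrh (hvr.symm.trans (hD.repAt_succ_self v))
      · intro he
        refine hD.not_anc_of_recordedAt huv ?_
        rw [← hvr, ← he]
        exact anc_repAt _ _
    · rintro ⟨u, v, huv, hu, hv, hvh, hne, ha, hb⟩
      exact ⟨_, ⟨v, hv, hvh, rfl⟩, newSched_buState.2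
        ⟨u, v, hD.recordedAt_of_mem_body huv hu hv hvh hne, ha, hb⟩⟩
  · constructor
    · rintro ⟨_, ⟨p, hp, rfl⟩, ha, hb⟩
      refine ⟨p, hp.1, mem_body_of_isBack hp, ha.trans ?_, hb⟩
      -- `addComponent` applies `rep` to elements that are already representatives; idempotence
      -- makes this harmless.
      exact congrArg (D.exitAt E _) (hD.repAt_repAt _ _)
    · rintro ⟨p, hph, hp, ha, hb⟩
      refine ⟨_, ⟨p, isBack_of_mem_body hp hph, rfl⟩, ha.trans ?_, hb⟩
      exact (congrArg (D.exitAt E _) (hD.repAt_repAt _ _)).symm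

theorem IsDepthFirst.mergeAll_eq [Finite V] (hD : D.IsDepthFirst E) (h w : V) :
    (D.buState E (D.dfn h + 1) (D.dfn h + 1)).mergeAll (D.nestedReps E h) h w =
      D.repAt E (D.dfn h) w := by
  by_cases hc : ∃ v ∈ D.nestedReps E h, D.repAt E (D.dfn h + 1) w = D.repAt E (D.dfn h + 1) v ∨
      D.repAt E (D.dfn h + 1) w = D.repAt E (D.dfn h + 1) h
  · refine (if_pos hc).trans ?_
    obtain ⟨r, hr, hw⟩ := hc
    obtain ⟨hr, _, hrr⟩ := hD.mem_nestedReps_iff.1 hr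
    refine (hD.repAt_dfn ?_).symm
    rw [hrr, hD.repAt_succ_self] at hw
    refine body_subset ?_ (mem_body_repAt (D.dfn h + 1) w)
    rcases hw with hw | hw
    · rwa [hw]
    · rw [hw]
      exact mem_body_self h
  · refine (if_neg hc).trans ?_
    simp only [buState]
    by_cases hw : w ∈ D.body E h
    · rw [hD.repAt_dfn hw]
      by_cases hwh : w = h
      · rw [hwh, hD.repAt_succ_self]
      · exact absurd ⟨_, ⟨w, hw, hwh, rfl⟩, .inl (hD.repAt_repAt _ _).symm⟩ hc
    · exact (hD.repAt_dfn_of_notMem hw).symm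

theorem IsDepthFirst.addComponent_buState [Finite V] (hD : D.IsDepthFirst E) {h : V}
    (hback : ∃ p, D.IsBack E p h) :
    (D.buState E (D.dfn h + 1) (D.dfn h + 1)).addComponent E D false h (D.nestedReps E h)
      ((D.buState E (D.dfn h + 1) (D.dfn h + 1)).backReps E D h) =
      D.buState E (D.dfn h + 1) (D.dfn h) := by
  have hmerge : (D.buState E (D.dfn h + 1) (D.dfn h + 1)).mergeAll (D.nestedReps E h) h =
      D.repAt E (D.dfn h) := funext (hD.mergeAll_eq h)
  unfold BUState.addComponent
  rw [hmerge]
  simp only [buState, BUState.mk.injEq, true_and, and_true]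
  refine ⟨?_, ?_, ?_, ?_⟩
  · ext a
    simp only [Set.mem_union, Set.mem_ofPred_eq, Set.mem_singleton_iff, hD.dfn_le_iff (h := h),
      or_and_right, exists_or, exists_eq_left, hback, true_and]
  · funext a b
    refine propext ?_
    simp only [hD.dfn_le_iff (h := h), or_and_right, exists_or, exists_eq_left]
    exact or_congr_right hD.newSched_iff_headSched
  · funext a b
    refine propext ?_
    simp only [hD.dfn_le_iff (h := h), or_and_right, exists_or, exists_eq_left, hback, true_and]
  · classical
    funext r
    by_cases hr : r = h
    · subst hr
      simp [exitAt, exitOf, hback]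
    · refine (Function.update_of_ne hr _ _).trans ?_
      simp only [exitAt, hD.dfn_le_iff (h := h), hr, or_false]

/-- Without back edges the body is just `h`, so processing `h` contributes nothing and the skipped
round agrees with the closed form. -/
theorem IsDepthFirst.buState_succ_of_not_isBack [Finite V] (hD : D.IsDepthFirst E) {h : V}
    (hback : ¬ ∃ p, D.IsBack E p h) :
    D.buState E (D.dfn h + 1) (D.dfn h + 1) = D.buState E (D.dfn h + 1) (D.dfn h) := by
  have hs := body_eq_singleton hback
  have hsched : ∀ a b, ¬ D.headSched E h a b := by
    rintro a b (⟨u, v, _, _, hv, hvh, _⟩ | ⟨u, huh, hu, _⟩)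
    · rw [hs] at hv
      exact hvh hv
    · exact hback ⟨u, isBack_of_mem_body hu huh⟩
  simp only [buState, BUState.mk.injEq, true_and, and_true]
  refine ⟨?_, ?_, ?_, ?_, ?_⟩
  · ext a
    simp only [Set.mem_ofPred_eq, hD.dfn_le_iff (h := h), or_and_right, exists_or, exists_eq_left,
      hback, false_and, or_false]
  · funext a b
    simp only [hD.dfn_le_iff (h := h), or_and_right, exists_or, exists_eq_left, hsched, or_false]
  · funext a b
    simp only [hD.dfn_le_iff (h := h), or_and_right, exists_or, exists_eq_left, hback, false_and,
      or_false]
  · funext w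
    by_cases hw : w ∈ D.body E h
    · rw [hD.repAt_dfn hw]
      rw [hs] at hw
      rw [Set.mem_singleton_iff.1 hw, hD.repAt_succ_self]
    · exact (hD.repAt_dfn_of_notMem hw).symm
  · funext r
    by_cases hr : r = h
    · subst hr
      simp [exitAt, exitOf, hback]
    · simp only [exitAt, hD.dfn_le_iff (h := h), hr, or_false]

theorem IsDepthFirst.constructWPOForSCC_iff [Finite V] (hD : D.IsDepthFirst E) {h : V}
    {t : BUState V} :
    BUState.ConstructWPOForSCC E D false h (D.buState E (D.dfn h + 1) (D.dfn h + 1)) t ↔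
      t = D.buState E (D.dfn h + 1) (D.dfn h) := by
  have hP : (D.buState E (D.dfn h + 1) (D.dfn h + 1)).backReps E D h ≠ ∅ ↔
      ∃ p, D.IsBack E p h := by
    rw [← Set.nonempty_iff_ne_empty]
    exact ⟨fun ⟨_, p, hp, _⟩ => ⟨p, hp⟩, fun ⟨p, hp⟩ => ⟨_, p, hp, rfl⟩⟩
  have hunfold : BUState.ConstructWPOForSCC E D false h
      (D.buState E (D.dfn h + 1) (D.dfn h + 1)) t ↔ _ :=
    exists_congr fun N => exists_congr fun P => and_congr_left fun _ => hD.findNestedSCCs_iff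
  rw [hunfold]
  by_cases hback : ∃ p, D.IsBack E p h
  · constructor
    · rintro ⟨N, P, ⟨rfl, rfl⟩, ⟨h1, _⟩ | ⟨_, rfl⟩⟩
      · exact absurd h1 (hP.2 hback)
      · exact hD.addComponent_buState hback
    · rintro rfl
      exact ⟨_, _, ⟨rfl, rfl⟩, .inr ⟨hP.2 hback, (hD.addComponent_buState hback).symm⟩⟩
  · constructor
    · rintro ⟨N, P, ⟨rfl, rfl⟩, ⟨_, rfl⟩ | ⟨h1, _⟩⟩
      · exact hD.buState_succ_of_not_isBack hback
      · exact absurd (hP.1 h1) hback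
    · rintro rfl
      exact ⟨_, _, ⟨rfl, rfl⟩, .inl ⟨not_not.1 fun h1 => hback (hP.1 h1),
        (hD.buState_succ_of_not_isBack hback).symm⟩⟩

/-- The first `m` vertices of the order remain to be processed, beginning with the one numbered `m -
1`. The final `j` is `1` because the virtual root, of level `0`, is restored only after the loop. -/
theorem IsDepthFirst.mainLoop_take_iff [Finite V] (hD : D.IsDepthFirst E) {m : ℕ}
    (hm : m ≤ D.order.length) {s : BUState V} :
    BUState.MainLoop E D false (D.order.take m).reverse (D.buState E (m + 1) m) s ↔
      s = D.buState E 1 0 := by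
  induction m with
  | zero =>
    simp only [List.take_zero, List.reverse_nil]
    constructor
    · rintro ⟨⟩
      rfl
    · rintro rfl
      exact .nil _
  | succ m ih =>
    obtain ⟨h, hh⟩ : ∃ h, D.order[m] = h := ⟨_, rfl⟩
    have hdfn : D.dfn h = m := by
      classical
      rw [← hh]
      exact hD.nodup.idxOf_getElem m hm
    have hlist : (D.order.take (m + 1)).reverse = h :: (D.order.take m).reverse := by
      rw [List.take_succ_eq_append_getElem hm, List.reverse_append, hh]
      rfl
    have hrestore := hD.restore_buState (some h)
    simp only [lvl] at hrestore
    rw [hlist, ← ih (Nat.le_of_succ_le hm)]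
    subst hdfn
    constructor
    · rintro (_ | ⟨_, _, _, t, _, hstep, hrest⟩)
      rw [hrestore, hD.constructWPOForSCC_iff] at hstep
      rwa [hstep] at hrest
    · intro hrest
      refine .cons _ _ _ _ _ ?_ hrest
      rw [hrestore]
      exact hD.constructWPOForSCC_iff.2 rfl

/-- At level `0` every edge has been restored, so `recordedAt_repAt` covers all edges between
different classes. -/
theorem IsDepthFirst.newSched_iff_topSched [Finite V] (hD : D.IsDepthFirst E) {a b : Node V} :
    (∃ r, D.repAt E 0 r = r ∧ (D.buState E 0 0).newSched E D false r a b) ↔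
      D.topSched E a b := by
  constructor
  · rintro ⟨r, hr, hs⟩
    obtain ⟨u, v, huv, ha, hb⟩ := newSched_buState.1 hs
    refine ⟨u, v, hD.edge_of_recordedAt huv, fun he => ?_, ha, hb⟩
    refine hD.not_anc_of_recordedAt huv ?_
    rw [← hD.repAt_of_recordedAt hr huv, ← he]
    exact anc_repAt _ _
  · rintro ⟨u, v, huv, hne, ha, hb⟩
    exact ⟨_, hD.repAt_repAt 0 v, newSched_buState.2 ⟨u, v,
      hD.recordedAt_repAt huv (Nat.zero_le _) hne fun _ _ => Nat.zero_le _, ha, hb⟩⟩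

/-- The closed form of the result of the bottom-up construction. -/
def bottomUpTuple (D : DFForest V) (E : V → V → Prop) : WPOTuple V where
  verts := Set.range Node.vtx
  exits := {a | ∃ g, (∃ p, D.IsBack E p g) ∧ a = Node.exit g}
  sched a b := (∃ g, D.headSched E g a b) ∨ D.topSched E a b
  stab a b := ∃ g, (∃ p, D.IsBack E p g) ∧ a = Node.exit g ∧ b = Node.vtx g

theorem IsDepthFirst.constructWPOBU_iff [Finite V] (hD : D.IsDepthFirst E) {W : WPOTuple V} :
    ConstructWPOBU E D false W ↔ W = D.bottomUpTuple E := by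
  have hloop : ∀ s, BUState.MainLoop E D false D.order.reverse (BUState.init E D) s ↔
      s = D.buState E 1 0 := by
    intro s
    rw [hD.init_eq, ← hD.mainLoop_take_iff le_rfl, List.take_length]
  have hconnect : ((D.buState E 1 0).restoreCrossForwardEdges none).connectWPOsOfMaximalSCCs
      E D false = D.bottomUpTuple E := by
    have hrestore := hD.restore_buState none
    simp only [lvl] at hrestore
    rw [hrestore]
    refine WPOTuple.ext rfl ?_ ?_ ?_
    · ext a
      simp [BUState.connectWPOsOfMaximalSCCs, bottomUpTuple, buState]
    · funext a b
      refine propext (or_congr ?_ hD.newSched_iff_topSched)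
      simp [buState]
    · funext a b
      simp [BUState.connectWPOsOfMaximalSCCs, bottomUpTuple, buState]
  constructor
  · rintro ⟨s, hs, rfl⟩
    rw [(hloop s).1 hs, hconnect]
  · rintro rfl
    exact ⟨_, (hloop _).2 rfl, hconnect.symm⟩

theorem IsDepthFirst.constructWPOTD_sched_iff [Finite V] (hD : D.IsDepthFirst E) (a b : Node V) :
    (ConstructWPOTD E D).sched a b ↔ (∃ g, D.headSchedTD E g a b) ∨ D.topSched E a b := by
  rw [hD.constructWPOTD.sched]
  simp only [Set.mem_univ, true_and]
  refine or_congr_right ((or_iff_left ?_).trans ?_)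
  · rintro ⟨u, x, ⟨v, hv⟩, _⟩
    cases hv
  · rfl

theorem headSchedTD_iff_of_not_looped {a b : Node V}
    (hab : ¬ ∃ h, IsLoopedHead E D h ∧ a = Node.vtx h ∧ (b = Node.vtx h ∨ b = Node.exit h))
    (g : V) : D.headSchedTD E g a b ↔ D.headSched E g a b := by
  constructor
  · rintro (h | ⟨hl, ha, hb⟩)
    · exact h.1
    · exact absurd ⟨g, hl, ha, .inl hb⟩ hab
  · exact fun h => .inl ⟨h, fun ⟨hl, ha, hb⟩ => hab ⟨g, hl, ha, .inr hb⟩⟩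

end DFForest

-- Comparison of the two closed forms

theorem mainTheorem4 {V : Type*} [Finite V] (E : V → V → Prop) (D : DFForest V)
    (hD : IsDFF E D) :
    (∃ W, ConstructWPOBU E D false W) ∧
    ∀ W, ConstructWPOBU E D false W →
      (ConstructWPOTD E D).verts = W.verts ∧
      (ConstructWPOTD E D).exits = W.exits ∧
      (ConstructWPOTD E D).stab = W.stab ∧
      (∀ a b : Node V,
        (¬ ∃ h, IsLoopedHead E D h ∧ a = Node.vtx h ∧ (b = Node.vtx h ∨ b = Node.exit h)) →
          ((ConstructWPOTD E D).sched a b ↔ W.sched a b)) ∧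
      ((∀ h, ¬ IsLoopedHead E D h) → ConstructWPOTD E D = W) := by
  replace hD := hD.isDepthFirst
  refine ⟨⟨_, hD.constructWPOBU_iff.2 rfl⟩, fun W hW => ?_⟩
  rw [hD.constructWPOBU_iff] at hW
  subst hW
  have hTD := hD.constructWPOTD
  have hverts : (ConstructWPOTD E D).verts = (D.bottomUpTuple E).verts := hTD.verts
  have hexits : (ConstructWPOTD E D).exits = (D.bottomUpTuple E).exits := by
    ext a
    simp [hTD.exits, DFForest.bottomUpTuple]
  have hstab : (ConstructWPOTD E D).stab = (D.bottomUpTuple E).stab := by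
    funext a b
    simp [hTD.stab, DFForest.bottomUpTuple]
  have hsched : ∀ a b : Node V,
      (¬ ∃ h, IsLoopedHead E D h ∧ a = Node.vtx h ∧ (b = Node.vtx h ∨ b = Node.exit h)) →
        ((ConstructWPOTD E D).sched a b ↔ (D.bottomUpTuple E).sched a b) := by
    intro a b hab
    rw [hD.constructWPOTD_sched_iff]
    exact or_congr_left (exists_congr (DFForest.headSchedTD_iff_of_not_looped hab))
  refine ⟨hverts, hexits, hstab, hsched, fun hno => WPOTuple.ext hverts hexits ?_ hstab⟩
  funext a b
  exact propext (hsched a b fun ⟨h, hl, _⟩ => hno h hl)
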